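/- Let $n\ge 1$ and let $M^n=(\mathbb C^n\setminus\{0\})/\langle f\rangle$, $f(z)=2z$, be the standard Hopf manifold, with the complex structure induced from $\mathbb C^n$ and with the Hermitian metric $g$ whose components in the coordinates $z=(z_1,\dots,z_n)$ are $g_{i\bar j}=g\big(\tfrac{\partial}{\partial z_i},\tfrac{\partial}{\partial\bar z_j}\big)=\delta_{ij}/|z|^2$, where $|z|^2=|z_1|^2+\cdots+|z_n|^2$. The Bismut connection $\nabla^b$ of a Hermitian manifold $(M,g,J)$ is the unique connection on the tangent bundle with $\nabla^b g=0$ and $\nabla^b J=0$ whose torsion $T^b$ is totally skew-symmetric; let $R^b(x,y)z=\nabla^b_x\nabla^b_yz-\nabla^b_y\nabla^b_xz-\nabla^b_{[x,y]}z$ be its curvature, and let $\mathrm{Ric}^{b(1)}(x,y)=\sum_{i=1}^n g\big(R^b(x,y)e_i,\bar e_i\big)$ be its first Ricci curvature, where $\{e_1,\dots,e_n\}$ is a local unitary frame of type $(1,0)$ tangent vectors and everything is extended complex multilinearly. Then $\nabla^bT^b=0$ and $\nabla^bR^b=0$, that is, $(M^n,g)$ is Bismut Ambrose–Singer (BAS).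 Moreover, if $n\ge 3$, then $\mathrm{Ric}^{b(1)}$ does not vanish identically; in particular $R^b$ does not vanish identically, i.e. $(M^n,g)$ is not Bismut flat. -/

import Mathlib

open scoped Manifold ContDiff

noncomputable section

/-! ## Hermitian manifolds and the Bismut connection -/

section HermitianManifold

/-- A complex manifold is in particular a real manifold. -/
instance IsManifold.real_of_complex {E : Type*} [NormedAddCommGroup E] [NormedSpace ℂ E]
    {M : Type*} [TopologicalSpace M] [ChartedSpace E M] [IsManifold 𝓘(ℂ, E) ω M] :
    IsManifold 𝓘(ℝ, E) ω M := by
  refine isManifold_of_contDiffOn _ _ _ fun e e' he he' ↦ ?_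
  have h := (contDiffGroupoid ω 𝓘(ℂ, E)).compatible he he'
  rw [contDiffGroupoid, mem_groupoid_of_pregroupoid] at h
  exact ContDiffOn.restrict_scalars ℝ h.1


/-! A Hermitian manifold is a complex manifold `M` (modelled on the complex vector space `E`) with a
`HermitianMetric E M`. Its tangent bundle is the real one, with model `𝓘(ℝ, E)`; the preferred chart
at `x` identifies `TangentSpace 𝓘(ℝ, E) x` with `E`. -/

variable {E : Type*} [NormedAddCommGroup E] [NormedSpace ℂ E] [FiniteDimensional ℂ E]
  [CompleteSpace E] {M : Type*} [TopologicalSpace M] [ChartedSpace E M] [IsManifold 𝓘(ℂ, E) ω M]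

/-- The almost complex structure `J` of a complex manifold: multiplication by `i` in the preferred
holomorphic chart at `x` (hence in every holomorphic chart, the coordinate changes being
holomorphic). -/
def complexStructure (x : M) : TangentSpace 𝓘(ℝ, E) x →L[ℝ] TangentSpace 𝓘(ℝ, E) x :=
  (Complex.I • ContinuousLinearMap.id ℝ E : E →L[ℝ] E)

variable (E M) in
/-- A Hermitian metric: a smooth Riemannian metric for which `J` is orthogonal. -/
structure HermitianMetric extends Bundle.ContMDiffRiemannianMetric 𝓘(ℝ, E) ∞ E
    (fun x : M ↦ TangentSpace 𝓘(ℝ, E) x) where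
  hermitian (x : M) (u v : TangentSpace 𝓘(ℝ, E) x) :
    inner x (complexStructure x u) (complexStructure x v) = inner x u v

/-- The vector field `Y` (a section of the tangent bundle) is differentiable at `x`. -/
def DifferentiableFieldAt (Y : (x : M) → TangentSpace 𝓘(ℝ, E) x) (x : M) : Prop :=
  MDifferentiableAt 𝓘(ℝ, E) 𝓘(ℝ, E).tangent
    (fun y ↦ (⟨y, Y y⟩ : TangentBundle 𝓘(ℝ, E) M)) x

variable (E M) in
/-- Affine connections on `M`: covariant derivatives on the real tangent bundle. As always in
Mathlib, `D Y x v` is `(∇_v Y)(x)`. -/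
abbrev AffineConnection := CovariantDerivative 𝓘(ℝ, E) E (fun x : M ↦ TangentSpace 𝓘(ℝ, E) x)

/-- `D` is the Bismut connection of `g`: the (smooth) connection with `∇g = 0` and `∇J = 0` whose
torsion is totally skew-symmetric. -/
structure HermitianMetric.IsBismut (g : HermitianMetric E M) (D : AffineConnection E M) : Prop where
  smooth : D.ContMDiffCovariantDerivative ∞
  metric {x : M} {Y Z : (x : M) → TangentSpace 𝓘(ℝ, E) x}
    (_ : DifferentiableFieldAt Y x) (_ : DifferentiableFieldAt Z x) (v : TangentSpace 𝓘(ℝ, E) x) :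
    mfderiv 𝓘(ℝ, E) 𝓘(ℝ, ℝ) (fun y ↦ g.inner y (Y y) (Z y)) x v =
      g.inner x (D Y x v) (Z x) + g.inner x (Y x) (D Z x v)
  complex {x : M} {Y : (x : M) → TangentSpace 𝓘(ℝ, E) x}
    (_ : DifferentiableFieldAt Y x) (v : TangentSpace 𝓘(ℝ, E) x) :
    D (fun y ↦ complexStructure y (Y y)) x v = complexStructure x (D Y x v)
  skew (x : M) (u v w : TangentSpace 𝓘(ℝ, E) x) :
    g.inner x (D.torsion x u v) w = - g.inner x (D.torsion x u w) v

namespace AffineConnection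

/-- Extension of a tangent vector at `x` to a vector field that is smooth near `x`. -/
def extendField {x : M} (u : TangentSpace 𝓘(ℝ, E) x) : (y : M) → TangentSpace 𝓘(ℝ, E) y :=
  FiberBundle.extend E (E := fun y : M ↦ TangentSpace 𝓘(ℝ, E) y) u

/-- The curvature tensor `R(u, v) w = ∇_X ∇_Y Z - ∇_Y ∇_X Z - ∇_[X, Y] Z` at `x`, where `X`, `Y`,
`Z` are vector fields that are smooth near `x` with values `u`, `v`, `w` at `x`. -/
def curvature (D : AffineConnection E M) (x : M) (u v w : TangentSpace 𝓘(ℝ, E) x) :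
    TangentSpace 𝓘(ℝ, E) x :=
  D (fun y ↦ D (extendField w) y (extendField v y)) x u
    - D (fun y ↦ D (extendField w) y (extendField u y)) x v
    - D (extendField w) x (VectorField.mlieBracket 𝓘(ℝ, E) (extendField u) (extendField v) x)

/-- `∇T = 0`, i.e. `∇_v (T(X, Y)) = T(∇_v X, Y) + T(X, ∇_v Y)`. -/
def HasParallelTorsion (D : AffineConnection E M) : Prop :=
  ∀ (x : M) (X Y : (x : M) → TangentSpace 𝓘(ℝ, E) x) (v : TangentSpace 𝓘(ℝ, E) x),
    DifferentiableFieldAt X x → DifferentiableFieldAt Y x →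
    D (fun y ↦ D.torsion y (X y) (Y y)) x v =
      D.torsion x (D X x v) (Y x) + D.torsion x (X x) (D Y x v)

/-- `∇R = 0`, i.e. `∇_v (R(X, Y) Z) = R(∇_v X, Y) Z + R(X, ∇_v Y) Z + R(X, Y) ∇_v Z`. -/
def HasParallelCurvature (D : AffineConnection E M) : Prop :=
  ∀ (x : M) (X Y Z : (x : M) → TangentSpace 𝓘(ℝ, E) x) (v : TangentSpace 𝓘(ℝ, E) x),
    DifferentiableFieldAt X x → DifferentiableFieldAt Y x → DifferentiableFieldAt Z x →
    D (fun y ↦ D.curvature y (X y) (Y y) (Z y)) x v =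
      D.curvature x (D X x v) (Y x) (Z x) + D.curvature x (X x) (D Y x v) (Z x)
        + D.curvature x (X x) (Y x) (D Z x v)

/-- The curvature vanishes identically. -/
def IsFlat (D : AffineConnection E M) : Prop :=
  ∀ (x : M) (u v w : TangentSpace 𝓘(ℝ, E) x), D.curvature x u v w = 0

end AffineConnection

namespace HermitianMetric

variable (g : HermitianMetric E M)

/-- A Hermitian manifold is Bismut Ambrose-Singer (BAS) if it has a Bismut connection, and the
Bismut connection has parallel torsion and parallel curvature. -/
def IsBismutAmbroseSinger : Prop :=
  (∃ D : AffineConnection E M, g.IsBismut D) ∧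
    ∀ D : AffineConnection E M, g.IsBismut D → D.HasParallelTorsion ∧ D.HasParallelCurvature

/-- `ε₁, …, εₙ` are real tangent vectors such that `ε₁, …, εₙ, Jε₁, …, Jεₙ` is an orthonormal basis,
i.e. such that `eᵢ = (εᵢ - √-1 Jεᵢ) / √2` is a unitary frame of the space of `(1,0)` vectors. -/
def IsUnitaryFrame (x : M) (ε : Fin (Module.finrank ℂ E) → TangentSpace 𝓘(ℝ, E) x) : Prop :=
  ∀ i j, g.inner x (ε i) (ε j) = (if i = j then 1 else 0) ∧
    g.inner x (ε i) (complexStructure x (ε j)) = 0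

/-- `R(u, v, a, b) = g(R(u, v) a, b)`, extended complex bilinearly in the last two positions to the
complexified tangent space, in which a pair `(p, q)` stands for `p + √-1 q`. -/
def complexCurvature (D : AffineConnection E M) (x : M) (u v : TangentSpace 𝓘(ℝ, E) x)
    (a b : TangentSpace 𝓘(ℝ, E) x × TangentSpace 𝓘(ℝ, E) x) : ℂ :=
  ⟨g.inner x (D.curvature x u v a.1) b.1 - g.inner x (D.curvature x u v a.2) b.2,
    g.inner x (D.curvature x u v a.1) b.2 + g.inner x (D.curvature x u v a.2) b.1⟩

/-- The first Ricci curvature `Ric⁽¹⁾(u, v) = ∑ᵢ R(u, v, eᵢ, ēᵢ)` of `D`, computed in the unitary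
frame `eᵢ = (εᵢ - √-1 Jεᵢ) / √2`. -/
def firstRicci (D : AffineConnection E M) (x : M)
    (ε : Fin (Module.finrank ℂ E) → TangentSpace 𝓘(ℝ, E) x) (u v : TangentSpace 𝓘(ℝ, E) x) : ℂ :=
  ∑ i, g.complexCurvature D x u v
    ((√2)⁻¹ • ε i, -((√2)⁻¹ • complexStructure x (ε i)))
    ((√2)⁻¹ • ε i, (√2)⁻¹ • complexStructure x (ε i))

/-- The first Ricci curvature of `D` vanishes identically. -/
def FirstRicciVanishes (D : AffineConnection E M) : Prop :=
  ∀ (x : M) (ε : Fin (Module.finrank ℂ E) → TangentSpace 𝓘(ℝ, E) x), g.IsUnitaryFrame x ε →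
    ∀ u v : TangentSpace 𝓘(ℝ, E) x, g.firstRicci D x ε u v = 0

end HermitianMetric

end HermitianManifold

/-! ## The Hopf manifold `(V ∖ {0}) / ⟨z ↦ 2z⟩` and its metric -/

section Hopf

variable {V : Type*} [NormedAddCommGroup V] [InnerProductSpace ℂ V]

variable (V) in
/-- `V ∖ {0}`, as an open subset of `V`. -/
abbrev Punctured : TopologicalSpace.Opens V := ⟨{0}ᶜ, isOpen_compl_singleton⟩

theorem Punctured.ne_zero (z : Punctured V) : (z : V) ≠ 0 := z.2

variable (V) in
/-- The dilation `z ↦ 2z` of `V ∖ {0}`. -/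
def doubling : Equiv.Perm (Punctured V) where
  toFun z := ⟨(2 : ℂ) • (z : V), smul_ne_zero two_ne_zero z.2⟩
  invFun z := ⟨(2 : ℂ)⁻¹ • (z : V), smul_ne_zero (inv_ne_zero two_ne_zero) z.2⟩
  left_inv z := by ext1; simp
  right_inv z := by ext1; simp

variable (V) in
/-- The cyclic group generated by `z ↦ 2z`. -/
abbrev DoublingGroup := Subgroup.zpowers (doubling V)

theorem doubling_zpow_apply (k : ℤ) (z : Punctured V) :
    (((doubling V ^ k) z : Punctured V) : V) = (2 : ℂ) ^ k • (z : V) := by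
  have hnat : ∀ (m : ℕ) (w : Punctured V),
      (((doubling V ^ m) w : Punctured V) : V) = (2 : ℂ) ^ m • (w : V) := by
    intro m
    induction m with
    | zero => intro w; simp
    | succ m ih =>
      intro w
      rw [pow_succ, Equiv.Perm.mul_apply, ih, pow_succ, mul_smul]
      rfl
  cases k with
  | ofNat m => simpa using hnat m z
  | negSucc m =>
    have h := hnat (m + 1) ((doubling V ^ (Int.negSucc m)) z)
    rw [← Equiv.Perm.mul_apply, zpow_negSucc, mul_inv_cancel] at h
    rw [zpow_negSucc, zpow_negSucc, eq_inv_smul_iff₀ (pow_ne_zero _ two_ne_zero)]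
    exact h.symm

theorem norm_two_zpow (k : ℤ) : ‖(2 : ℂ) ^ k‖ = (2 : ℝ) ^ k := by simp

instance : ContinuousConstSMul (DoublingGroup V) (Punctured V) where
  continuous_const_smul := by
    rintro ⟨_, k, rfl⟩
    refine continuous_induced_rng.2 ?_
    have : (Subtype.val ∘ fun z : Punctured V ↦
        ((doubling V ^ k) z : Punctured V)) = fun z : Punctured V ↦ (2 : ℂ) ^ k • (z : V) :=
      funext fun z ↦ doubling_zpow_apply k z
    exact (continuous_subtype_val.const_smul ((2 : ℂ) ^ k)).congr fun z ↦ (congrFun this z).symm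

instance : IsCancelSMul (DoublingGroup V) (Punctured V) where
  left_cancel' g a b h := smul_left_cancel g h
  right_cancel' := by
    rintro ⟨_, k, rfl⟩ ⟨_, l, rfl⟩ z h
    have h' : (2 : ℂ) ^ k • (z : V) = (2 : ℂ) ^ l • (z : V) := by
      rw [← doubling_zpow_apply, ← doubling_zpow_apply]
      exact congrArg Subtype.val h
    have h2 := congrArg norm (smul_left_injective ℂ (Punctured.ne_zero z) h')
    rw [norm_two_zpow, norm_two_zpow] at h2
    have hkl : k = l := zpow_right_injective₀ (by norm_num) (by norm_num) h2
    subst hkl; rfl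

variable [FiniteDimensional ℂ V]

instance : LocallyCompactSpace (Punctured V) :=
  haveI := FiniteDimensional.proper ℂ V
  (Punctured V).isOpen.locallyCompactSpace

instance : ProperlyDiscontinuousSMul (DoublingGroup V) (Punctured V) where
  finite_disjoint_inter_image := by
    intro K L hK hL
    have hbd : ∀ S : Set (Punctured V), IsCompact S →
        ∃ m : ℕ, ∀ z ∈ S, (2 : ℝ) ^ (-(m : ℤ)) ≤ ‖(z : V)‖ ∧ ‖(z : V)‖ ≤ (2 : ℝ) ^ (m : ℤ) := by
      intro S hS
      obtain ⟨B, hB⟩ := (hS.image (f := fun z : Punctured V ↦ ‖(z : V)‖)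
        (by fun_prop)).bddAbove
      obtain ⟨A, hA⟩ := (hS.image (f := fun z : Punctured V ↦ ‖(z : V)‖⁻¹)
        (Continuous.inv₀ (by fun_prop) fun z ↦ norm_ne_zero_iff.2 (Punctured.ne_zero z))).bddAbove
      obtain ⟨m, hm⟩ := pow_unbounded_of_one_lt (max A B) (one_lt_two (α := ℝ))
      refine ⟨m, fun z hz ↦ ⟨?_, ?_⟩⟩
      · have h1 : ‖(z : V)‖⁻¹ ≤ (2 : ℝ) ^ m :=
          (hA ⟨z, hz, rfl⟩).trans ((le_max_left _ _).trans hm.le)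
        rw [zpow_neg, zpow_natCast]
        exact inv_le_of_inv_le₀ (norm_pos_iff.2 (Punctured.ne_zero z)) h1
      · rw [zpow_natCast]
        exact (hB ⟨z, hz, rfl⟩).trans ((le_max_right _ _).trans hm.le)
    obtain ⟨a, ha⟩ := hbd K hK
    obtain ⟨b, hb⟩ := hbd L hL
    refine ((Set.finite_Icc (-((a : ℤ) + b)) (a + b)).image
      fun k : ℤ ↦ (⟨doubling V ^ k, k, rfl⟩ : DoublingGroup V)).subset ?_
    rintro ⟨_, k, rfl⟩ ⟨_, ⟨z, hz, rfl⟩, hL'⟩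
    have hn : ‖(((doubling V ^ k) z : Punctured V) : V)‖ = (2 : ℝ) ^ k * ‖(z : V)‖ := by
      rw [doubling_zpow_apply, norm_smul, norm_two_zpow]
    obtain ⟨h1, h2⟩ := ha z hz
    obtain ⟨h3, h4⟩ := hb _ hL'
    change _ ≤ ‖(((doubling V ^ k) z : Punctured V) : V)‖ at h3
    change ‖(((doubling V ^ k) z : Punctured V) : V)‖ ≤ _ at h4
    rw [hn] at h3 h4
    have p : (0 : ℝ) < 2 ^ k := by positivity
    refine ⟨k, ⟨?_, ?_⟩, rfl⟩
    · have : (2 : ℝ) ^ (-(b : ℤ)) ≤ 2 ^ (k + a) := by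
        rw [zpow_add₀ two_ne_zero]
        exact h3.trans (mul_le_mul_of_nonneg_left h2 p.le)
      have := (zpow_le_zpow_iff_right₀ (one_lt_two (α := ℝ))).1 this
      lia
    · have : (2 : ℝ) ^ (k + -(a : ℤ)) ≤ 2 ^ (b : ℤ) := by
        rw [zpow_add₀ two_ne_zero]
        exact (mul_le_mul_of_nonneg_left h1 p.le).trans h4
      have := (zpow_le_zpow_iff_right₀ (one_lt_two (α := ℝ))).1 this
      lia

variable (V) in
/-- The Hopf manifold: the quotient of `V ∖ {0}` by the group generated by `z ↦ 2z`. Its charts (from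
Mathlib's instance for quotients by free, properly discontinuous actions) are the local inverses of
the projection. -/
abbrev Hopf := MulAction.orbitRel.Quotient (DoublingGroup V) (Punctured V)

/-- The projection `V ∖ {0} → Hopf V`. -/
def Hopf.proj (z : Punctured V) : Hopf V := Quotient.mk _ z

theorem Hopf.proj_eq_iff {z w : Punctured V} :
    Hopf.proj z = Hopf.proj w ↔ ∃ k : ℤ, (z : V) = (2 : ℂ) ^ k • (w : V) := by
  refine Quotient.eq''.trans ⟨?_, ?_⟩
  · rintro ⟨⟨_, k, rfl⟩, h⟩
    exact ⟨k, by rw [← doubling_zpow_apply]; exact congrArg Subtype.val h.symm⟩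
  · rintro ⟨k, h⟩
    exact ⟨⟨_, k, rfl⟩, Subtype.ext ((doubling_zpow_apply k w).trans h.symm)⟩


theorem Hopf.chart_spec {e : OpenPartialHomeomorph (Hopf V) (V)}
    (he : e ∈ atlas (V) (Hopf V)) {x : Hopf V} (hx : x ∈ e.source) :
    ∃ h : e x ≠ 0, Hopf.proj ⟨e x, h⟩ = x := by
  obtain ⟨q, rfl⟩ := he
  rw [OpenPartialHomeomorph.trans_source] at hx
  refine ⟨Punctured.ne_zero _, ?_⟩
  exact IsLocalHomeomorph.apply_localInverseAt_of_mem _ hx.1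

theorem Hopf.transition {e e' : OpenPartialHomeomorph (Hopf V) (V)}
    (he : e ∈ atlas (V) (Hopf V)) (he' : e' ∈ atlas (V) (Hopf V)) {x : Hopf V}
    (hx : x ∈ e.source) (hx' : x ∈ e'.source) :
    ∃ k : ℤ, ∀ᶠ w in nhds (e x), e' (e.symm w) = (2 : ℂ) ^ k • w := by
  have key : ∀ᶠ w in nhds (e x), w ≠ 0 ∧ ∃ k : ℤ, e' (e.symm w) = (2 : ℂ) ^ k • w := by
    have h1 : ∀ᶠ w in nhds (e x), w ∈ e.target := e.open_target.mem_nhds (e.map_source hx)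
    have h2 : ∀ᶠ w in nhds (e x), e.symm w ∈ e'.source := by
      refine (e.continuousAt_symm (e.map_source hx)).preimage_mem_nhds ?_
      rw [e.left_inv hx]
      exact e'.open_source.mem_nhds hx'
    filter_upwards [h1, h2] with w hw hw'
    obtain ⟨a, ha⟩ := chart_spec he (e.map_target hw)
    obtain ⟨b, hb⟩ := chart_spec he' hw'
    obtain ⟨k, hk⟩ := proj_eq_iff.1 (hb.trans ha.symm)
    simp only [e.right_inv hw] at a hk
    exact ⟨a, k, hk⟩
  obtain ⟨h0, k, hk⟩ := key.self_of_nhds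
  have hcont : ContinuousAt (fun w ↦ ‖e' (e.symm w)‖ / ‖w‖) (e x) := by
    refine ContinuousAt.div ?_ continuous_norm.continuousAt (norm_ne_zero_iff.2 h0)
    refine ContinuousAt.norm (ContinuousAt.comp ?_ (e.continuousAt_symm (e.map_source hx)))
    rw [e.left_inv hx]
    exact e'.continuousAt hx'
  have hval : ‖e' (e.symm (e x))‖ / ‖e x‖ = (2 : ℝ) ^ k := by
    rw [hk, norm_smul, norm_two_zpow, mul_div_cancel_right₀ _ (norm_ne_zero_iff.2 h0)]
  have hlt : ∀ᶠ w in nhds (e x), ‖e' (e.symm w)‖ / ‖w‖ ∈ Set.Ioo ((2 : ℝ) ^ (k - 1)) (2 ^ (k + 1)) := by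
    refine hcont.preimage_mem_nhds ?_
    rw [hval]
    exact Ioo_mem_nhds (zpow_lt_zpow_right₀ one_lt_two (by lia))
      (zpow_lt_zpow_right₀ one_lt_two (by lia))
  refine ⟨k, ?_⟩
  filter_upwards [key, hlt] with w ⟨hw, l, hl⟩ ⟨ha, hb⟩
  rw [hl, norm_smul, norm_two_zpow, mul_div_cancel_right₀ _ (norm_ne_zero_iff.2 hw)] at ha hb
  have h1 := (zpow_lt_zpow_iff_right₀ (one_lt_two (α := ℝ))).1 ha
  have h2 := (zpow_lt_zpow_iff_right₀ (one_lt_two (α := ℝ))).1 hb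
  rw [hl, show l = k by lia]

instance : IsManifold 𝓘(ℂ, V) ω (Hopf V) := by
  refine isManifold_of_contDiffOn _ _ _ fun e e' he he' w hw ↦ ?_
  simp only [modelWithCornersSelf_coe_symm, Set.preimage_id, modelWithCornersSelf_coe,
    Set.range_id, Set.inter_univ, OpenPartialHomeomorph.trans_source,
    OpenPartialHomeomorph.symm_source] at hw
  obtain ⟨k, hk⟩ := Hopf.transition he he' (e.map_target hw.1) hw.2
  rw [e.right_inv hw.1] at hk
  refine ContDiffAt.contDiffWithinAt ?_
  refine ContDiffAt.congr_of_eventuallyEq (f := fun w ↦ (2 : ℂ) ^ k • w) ?_ hk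
  exact contDiffAt_id.const_smul _


theorem Hopf.tangentCoordChange_eq {x y : Hopf V} (hy : y ∈ (chartAt (V) x).source) :
    ∃ k : ℤ, chartAt (V) y y = (2 : ℂ) ^ k • chartAt (V) x y ∧
      ∀ v : V, tangentCoordChange 𝓘(ℝ, V) x y y v = (2 : ℂ) ^ k • v := by
  obtain ⟨k, hk⟩ := transition (chart_mem_atlas _ x) (chart_mem_atlas _ y) hy (mem_chart_source _ y)
  refine ⟨k, ?_, fun v ↦ ?_⟩
  · have := hk.self_of_nhds
    rwa [OpenPartialHomeomorph.left_inv _ hy] at this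
  · rw [tangentCoordChange_def]
    simp only [extChartAt, mfld_simps, fderivWithin_univ]
    have h : HasFDerivAt (fun w : V ↦ (2 : ℂ) ^ k • w)
        ((2 : ℂ) ^ k • ContinuousLinearMap.id ℝ (V)) (chartAt (V) x y) :=
      ((2 : ℂ) ^ k • ContinuousLinearMap.id ℝ (V)).hasFDerivAt
    have h' := h.congr_of_eventuallyEq (f₁ := chartAt (V) y ∘ (chartAt (V) x).symm) hk
    rw [h'.fderiv]
    rfl

theorem Hopf.continuous_proj : Continuous (Hopf.proj : Punctured V → Hopf V) :=
  continuous_quot_mk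

theorem Hopf.hasMFDerivAt_proj (z : Punctured V) :
    ∃ k : ℤ, chartAt V (Hopf.proj z) (Hopf.proj z) = (2 : ℂ) ^ k • (z : V) ∧
      HasMFDerivAt 𝓘(ℝ, V) 𝓘(ℝ, V) (Hopf.proj : Punctured V → Hopf V) z
        ((2 : ℂ) ^ k • ContinuousLinearMap.id ℝ V : V →L[ℝ] V) := by
  have hs := mem_chart_source V (Hopf.proj z)
  have he := chart_mem_atlas V (Hopf.proj z)
  set e := chartAt V (Hopf.proj z) with hedef
  have key : ∀ w : Punctured V, Hopf.proj w ∈ e.source →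
      ∃ k : ℤ, e (Hopf.proj w) = (2 : ℂ) ^ k • (w : V) := by
    intro w hw
    obtain ⟨a, ha⟩ := chart_spec he hw
    exact proj_eq_iff.1 ha
  obtain ⟨k, hk⟩ := key z hs
  refine ⟨k, hk, Hopf.continuous_proj.continuousAt, ?_⟩
  have hcont : ContinuousAt (fun w : Punctured V ↦ ‖e (Hopf.proj w)‖ / ‖(w : V)‖) z :=
    ((e.continuousAt hs).comp Hopf.continuous_proj.continuousAt).norm.div
      continuous_subtype_val.norm.continuousAt (norm_ne_zero_iff.2 (Punctured.ne_zero z))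
  have hval : ‖e (Hopf.proj z)‖ / ‖(z : V)‖ = (2 : ℝ) ^ k := by
    rw [hk, norm_smul, norm_two_zpow,
      mul_div_cancel_right₀ _ (norm_ne_zero_iff.2 (Punctured.ne_zero z))]
  have hlt : ∀ᶠ w : Punctured V in nhds z,
      ‖e (Hopf.proj w)‖ / ‖(w : V)‖ ∈ Set.Ioo ((2 : ℝ) ^ (k - 1)) (2 ^ (k + 1)) := by
    refine hcont.preimage_mem_nhds ?_
    rw [hval]
    exact Ioo_mem_nhds (zpow_lt_zpow_right₀ one_lt_two (by lia))
      (zpow_lt_zpow_right₀ one_lt_two (by lia))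
  have hsrc : ∀ᶠ w : Punctured V in nhds z, Hopf.proj w ∈ e.source :=
    Hopf.continuous_proj.continuousAt.preimage_mem_nhds (e.open_source.mem_nhds hs)
  have hev : ∀ᶠ w : Punctured V in nhds z, e (Hopf.proj w) = (2 : ℂ) ^ k • (w : V) := by
    filter_upwards [hlt, hsrc] with w ⟨ha, hb⟩ hw
    obtain ⟨l, hl⟩ := key w hw
    rw [hl, norm_smul, norm_two_zpow,
      mul_div_cancel_right₀ _ (norm_ne_zero_iff.2 (Punctured.ne_zero w))] at ha hb
    have h1 := (zpow_lt_zpow_iff_right₀ (one_lt_two (α := ℝ))).1 ha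
    have h2 := (zpow_lt_zpow_iff_right₀ (one_lt_two (α := ℝ))).1 hb
    rw [hl, show l = k by lia]
  have h : HasFDerivAt (fun w : V ↦ (2 : ℂ) ^ k • w)
      ((2 : ℂ) ^ k • ContinuousLinearMap.id ℝ V) (extChartAt 𝓘(ℝ, V) z z) :=
    ((2 : ℂ) ^ k • ContinuousLinearMap.id ℝ V).hasFDerivAt
  refine (h.congr_of_eventuallyEq ?_).hasFDerivWithinAt
  filter_upwards [(continuousAt_extChartAt_symm z).preimage_mem_nhds
      ((extChartAt_to_inv (I := 𝓘(ℝ, V)) z).symm ▸ hev),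
    extChartAt_target_mem_nhds (I := 𝓘(ℝ, V)) z] with w hw hw'
  have hw2 : e (Hopf.proj ((extChartAt 𝓘(ℝ, V) z).symm w)) =
    (2 : ℂ) ^ k • extChartAt 𝓘(ℝ, V) z ((extChartAt 𝓘(ℝ, V) z).symm w) := hw
  rw [PartialEquiv.right_inv _ hw'] at hw2
  exact hw2

variable (V) in
/-- `Re ⟨u, v⟩` as a real bilinear form. -/
def reInner : V →L[ℝ] V →L[ℝ] ℝ :=
  letI := InnerProductSpace.rclikeToReal ℂ V
  innerSL ℝ

/-- The inner product `2 Re ⟨u, v⟩ / |z|²` on the tangent space `V` at the point `x = [z]`, where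
`z = chartAt V x x` is the preferred lift of `x`. -/
def hopfInner (x : Hopf V) :
    TangentSpace 𝓘(ℝ, V) x →L[ℝ] TangentSpace 𝓘(ℝ, V) x →L[ℝ] ℝ :=
  ((2 / ‖chartAt V x x‖ ^ 2) • reInner V : V →L[ℝ] V →L[ℝ] ℝ)

theorem hopfInner_apply (x : Hopf V) (u v : V) :
    hopfInner x u v = 2 / ‖chartAt V x x‖ ^ 2 * (inner ℂ u v).re := rfl

theorem hopfInner_coeff_pos (x : Hopf V) : 0 < 2 / ‖chartAt V x x‖ ^ 2 := by
  obtain ⟨h0, -⟩ := Hopf.chart_spec (chart_mem_atlas V x) (mem_chart_source _ x)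
  exact div_pos two_pos (pow_pos (norm_pos_iff.2 h0) 2)

theorem contDiffAt_two_div_norm_sq_smul {F : Type*} [NormedAddCommGroup F] [NormedSpace ℝ F]
    {z : V} (hz : z ≠ 0) (B : F) : ContDiffAt ℝ ∞ (fun w : V ↦ (2 / ‖w‖ ^ 2) • B) z :=
  (contDiffAt_const.div (contDiff_norm_sq ℂ).contDiffAt
    (pow_ne_zero 2 (norm_ne_zero_iff.2 hz))).smul contDiffAt_const

theorem contMDiff_hopfInner :
    ContMDiff 𝓘(ℝ, V) (𝓘(ℝ, V).prod 𝓘(ℝ, V →L[ℝ] V →L[ℝ] ℝ)) ∞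
      (fun x : Hopf V ↦ Bundle.TotalSpace.mk' (V →L[ℝ] V →L[ℝ] ℝ)
        (E := fun x : Hopf V ↦ TangentSpace 𝓘(ℝ, V) x →L[ℝ] TangentSpace 𝓘(ℝ, V) x →L[ℝ] ℝ)
        x (hopfInner x)) := by
  intro x
  rw [Bundle.contMDiffAt_section]
  obtain ⟨h0, -⟩ := Hopf.chart_spec (chart_mem_atlas V x) (mem_chart_source _ x)
  have hsm : ContMDiffAt 𝓘(ℝ, V) 𝓘(ℝ, V →L[ℝ] V →L[ℝ] ℝ) ∞
      (fun y : Hopf V ↦ ((2 / ‖chartAt V x y‖ ^ 2) • reInner V : V →L[ℝ] V →L[ℝ] ℝ)) x := by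
    have h1 : ContMDiffAt 𝓘(ℝ, V) 𝓘(ℝ, V) ∞ (chartAt V x) x :=
      contMDiffAt_of_mem_maximalAtlas (IsManifold.chart_mem_maximalAtlas x) (mem_chart_source _ x)
    have h2 : ContDiffAt ℝ ∞ (fun w : V ↦
        ((2 / ‖w‖ ^ 2) • reInner V : V →L[ℝ] V →L[ℝ] ℝ)) (chartAt V x x) :=
      contDiffAt_two_div_norm_sq_smul h0 (reInner V)
    exact h2.contMDiffAt.comp x h1
  refine hsm.congr_of_eventuallyEq ?_
  filter_upwards [(chartAt V x).open_source.mem_nhds (mem_chart_source _ x)] with y hy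
  obtain ⟨k, hk, hk'⟩ := Hopf.tangentCoordChange_eq hy
  obtain ⟨hy0, -⟩ := Hopf.chart_spec (chart_mem_atlas V x) hy
  refine ContinuousLinearMap.ext fun u ↦ ContinuousLinearMap.ext fun v ↦ ?_
  have e : hopfInner y (tangentCoordChange 𝓘(ℝ, V) x y y u)
      (tangentCoordChange 𝓘(ℝ, V) x y y v) =
      2 / ‖chartAt V x y‖ ^ 2 * (inner ℂ u v).re := by
    have h2 : (0 : ℝ) < 2 ^ k := by positivity
    have h3 : ‖chartAt V x y‖ ≠ 0 := norm_ne_zero_iff.2 hy0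
    rw [hk', hk', hopfInner_apply, hk, inner_smul_left, inner_smul_right, ← mul_assoc,
      Complex.conj_mul', norm_smul, norm_two_zpow, ← Complex.ofReal_pow, Complex.re_ofReal_mul]
    field_simp
  refine Eq.trans (b := hopfInner y
    ((trivializationAt V (TangentSpace 𝓘(ℝ, V)) x).symmL ℝ y u)
    ((trivializationAt V (TangentSpace 𝓘(ℝ, V)) x).symmL ℝ y v)) ?_ ?_
  · simp [hom_trivializationAt_apply, ContinuousLinearMap.inCoordinates, hy]
  · rw [TangentBundle.symmL_trivializationAt_eq_core hy]
    exact e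

variable (V) in
/-- The standard Hermitian metric of the Hopf manifold, with components
`g(∂/∂zᵢ, ∂/∂z̄ⱼ) = δᵢⱼ / |z|²`. As `∂/∂xᵢ = ∂/∂zᵢ + ∂/∂z̄ᵢ`, the real inner product is
`2 Re ⟨u, v⟩ / |z|²`. -/
def hopfMetric : HermitianMetric V (Hopf V) where
  inner x := hopfInner x
  symm x u v := congrArg (2 / ‖chartAt V x x‖ ^ 2 * ·) (inner_re_symm (𝕜 := ℂ) (E := V) u v)
  pos x u hu := mul_pos (hopfInner_coeff_pos x) (by
    have hn : (inner ℂ (show V from u) (show V from u)).re = ‖(show V from u)‖ ^ 2 :=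
      inner_self_eq_norm_sq (𝕜 := ℂ) (show V from u)
    change 0 < (inner ℂ (show V from u) (show V from u)).re
    rw [hn]
    exact pow_pos (norm_pos_iff.2 hu) 2)
  isVonNBounded x := by
    have hc := hopfInner_coeff_pos x
    change Bornology.IsVonNBounded ℝ
      {v : V | 2 / ‖chartAt V x x‖ ^ 2 * (inner ℂ v v).re < 1}
    generalize 2 / ‖chartAt V x x‖ ^ 2 = c at hc
    refine (NormedSpace.isVonNBounded_closedBall ℝ V (1 / c + 1)).subset fun v hv ↦ ?_
    have hv' : c * (inner ℂ v v).re < 1 := hv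
    have hn : (inner ℂ v v).re = ‖v‖ ^ 2 := inner_self_eq_norm_sq (𝕜 := ℂ) v
    rw [hn, mul_comm, ← lt_div_iff₀ hc] at hv'
    have : 0 < 1 / c := by positivity
    rw [mem_closedBall_zero_iff]
    nlinarith [norm_nonneg v]
  contMDiff := contMDiff_hopfInner
  hermitian x u v := by
    refine (hopfInner_apply x (Complex.I • (show V from u)) (Complex.I • (show V from v))).trans
      (Eq.trans ?_ (hopfInner_apply x u v).symm)
    rw [inner_smul_left, inner_smul_right]
    simp

/-- The projection is a local isometry from `V ∖ {0}` with the metric `2 Re ⟨u, v⟩ / |z|²`. -/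
theorem hopfMetric_proj (z : Punctured V) (u v : V) :
    (hopfMetric V).inner (Hopf.proj z)
      (mfderiv 𝓘(ℝ, V) 𝓘(ℝ, V) (Hopf.proj : Punctured V → Hopf V) z u)
      (mfderiv 𝓘(ℝ, V) 𝓘(ℝ, V) (Hopf.proj : Punctured V → Hopf V) z v) =
      2 * (inner ℂ u v).re / ‖(z : V)‖ ^ 2 := by
  obtain ⟨k, hk, hd⟩ := Hopf.hasMFDerivAt_proj z
  rw [hd.mfderiv]
  have h2 : (0 : ℝ) < 2 ^ k := by positivity
  have h3 : ‖(z : V)‖ ≠ 0 := norm_ne_zero_iff.2 z.2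
  refine (hopfInner_apply (Hopf.proj z) ((2 : ℂ) ^ k • u) ((2 : ℂ) ^ k • v)).trans ?_
  rw [hk, inner_smul_left, inner_smul_right, ← mul_assoc,
    Complex.conj_mul', norm_smul, norm_two_zpow, ← Complex.ofReal_pow, Complex.re_ofReal_mul]
  field_simp

end Hopf

end

/-! Work upstairs on `V ∖ {0}` with the sesquilinear form h_p(u,v) = ⟨u,v⟩/|p|², conjugate linear in
u; the real metric is 2 Re h. Put ∇_v F = dF(v) + Γ_p(v,F) with Γ_p(u,v) = h(u,v)p − h(p,v)u −
h(u,p)v. Γ is complex linear in its second slot, so J is parallel. The real parts of its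
coefficients give the Levi-Civita symbol of |p|⁻²⟨·,·⟩ and the imaginary parts give half the
torsion, which as a 3-form is a multiple of Im h ∧ Im h(p,·).

Parallelism rests on two facts: h is parallel (`fderiv_hopfForm_eq_hopfCov`), and the position field
p ↦ p is parallel (`hopfCov_id`), because Γ_p(v,p) = −v. The torsion is an algebraic expression in h
and the position field. So is the curvature, which only sees the complex orthogonal complement of p
(`hopfCov_hopfCov_sub`). The Leibniz rule then gives ∇T = 0 and ∇R = 0 without further computation.

All these tensors are equivariant under scaling base point and vectors by the same c, so they
descend to the quotient, whose coordinate changes are locally multiplications by powers of 2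
(`ratio_smul_connection`). The statement concerns every Bismut connection, so uniqueness is also
needed: the difference of two is a 3-form compatible with J, and such a form vanishes
(`eq_zero_of_skew_of_complex`, `eq_connection_of_isBismut`).

For the Ricci form take u ≠ 0 with u ⊥ p. On w ⊥ p one has R(u,iu)w = 2i(h(u,u)w − h(u,w)u), and
R(u,iu)p = 0, so the complex trace is 2i(n−2)h(u,u), nonzero for n ≥ 3
(`sum_inner_hopfCurvature_I_smul`). -/

noncomputable section

/-! ## The Bismut connection of the cone metric `|z|⁻² ⟨u, v⟩` on `V ∖ {0}` -/

section Cone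

variable {V : Type*} [NormedAddCommGroup V] [InnerProductSpace ℂ V]

/-- The Hermitian form `⟨u, v⟩ / |p|²`. -/
def hopfForm (p u v : V) : ℂ := (inner ℂ p p)⁻¹ * inner ℂ u v

/-- The Christoffel symbol of the Bismut connection of `hopfForm`. -/
def hopfChristoffel (p u v : V) : V := hopfForm p u v • p - hopfForm p p v • u - hopfForm p u p • v

/-- The torsion of the Bismut connection of `hopfForm`. -/
def hopfTorsion (p u v : V) : V :=
  (hopfForm p u v - hopfForm p v u) • p + (hopfForm p v p - hopfForm p p v) • u
    + (hopfForm p p u - hopfForm p u p) • v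

/-- The projection to the orthogonal complement of `p`. -/
def hopfProj (p u : V) : V := u - hopfForm p p u • p

/-- The curvature of the Bismut connection of `hopfForm`. -/
def hopfCurvature (p u v w : V) : V :=
  (hopfForm p (hopfProj p u) (hopfProj p v) - hopfForm p (hopfProj p v) (hopfProj p u))
      • hopfProj p w
    + hopfForm p (hopfProj p v) (hopfProj p w) • hopfProj p u
    - hopfForm p (hopfProj p u) (hopfProj p w) • hopfProj p v

/-- The covariant derivative `∇_v F` at `p` for the Bismut connection of `hopfForm`. -/
def hopfCov (F : V → V) (p v : V) : V := fderiv ℝ F p v + hopfChristoffel p v (F p)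

/-! ### Sesquilinearity and homogeneity of the cone tensors -/

variable {p : V}

theorem hopfForm_conj (p u v : V) : (starRingEnd ℂ) (hopfForm p u v) = hopfForm p v u := by
  simp [hopfForm]

theorem hopfForm_add_left (p u u' v : V) :
    hopfForm p (u + u') v = hopfForm p u v + hopfForm p u' v := by
  simp [hopfForm, mul_add]

theorem hopfForm_add_right (p u v v' : V) :
    hopfForm p u (v + v') = hopfForm p u v + hopfForm p u v' := by
  simp [hopfForm, mul_add]

theorem hopfForm_sub_left (p u u' v : V) :
    hopfForm p (u - u') v = hopfForm p u v - hopfForm p u' v := by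
  simp [hopfForm, mul_sub]

theorem hopfForm_sub_right (p u v v' : V) :
    hopfForm p u (v - v') = hopfForm p u v - hopfForm p u v' := by
  simp [hopfForm, mul_sub]

theorem hopfForm_smul_left (p u v : V) (c : ℂ) :
    hopfForm p (c • u) v = (starRingEnd ℂ) c * hopfForm p u v := by
  simp [hopfForm]; ring

theorem hopfForm_smul_right (p u v : V) (c : ℂ) :
    hopfForm p u (c • v) = c * hopfForm p u v := by
  simp [hopfForm]; ring

theorem hopfForm_self (hp : p ≠ 0) : hopfForm p p p = 1 :=
  inv_mul_cancel₀ ((inner_self_ne_zero (𝕜 := ℂ)).2 hp)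

/-- The |c|² produced by the two arguments cancels the |c|² of the denominator. The equivariance of
Γ, of the projection, of T and of R all reduce to this, and it is what lets them descend to the
quotient. -/
theorem hopfForm_smul_smul {c : ℂ} (hc : c ≠ 0) (p u v : V) :
    hopfForm (c • p) (c • u) (c • v) = hopfForm p u v := by
  by_cases hp : p = 0
  · simp [hopfForm, hp]
  have := (inner_self_ne_zero (𝕜 := ℂ)).2 hp
  simp only [hopfForm, inner_smul_left, inner_smul_right]
  have h2 : (starRingEnd ℂ) c ≠ 0 := by simpa using hc
  field_simp

theorem hopfChristoffel_smul_smul {c : ℂ} (hc : c ≠ 0) (p u v : V) :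
    hopfChristoffel (c • p) (c • u) (c • v) = c • hopfChristoffel p u v := by
  simp only [hopfChristoffel, hopfForm_smul_smul hc]; module

theorem hopfProj_smul_smul {c : ℂ} (hc : c ≠ 0) (p u : V) :
    hopfProj (c • p) (c • u) = c • hopfProj p u := by
  simp only [hopfProj, hopfForm_smul_smul hc]; module

theorem hopfTorsion_smul_smul {c : ℂ} (hc : c ≠ 0) (p u v : V) :
    hopfTorsion (c • p) (c • u) (c • v) = c • hopfTorsion p u v := by
  simp only [hopfTorsion, hopfForm_smul_smul hc]; module

theorem hopfCurvature_smul_smul {c : ℂ} (hc : c ≠ 0) (p u v w : V) :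
    hopfCurvature (c • p) (c • u) (c • v) (c • w) = c • hopfCurvature p u v w := by
  simp only [hopfCurvature, hopfForm_smul_smul hc, hopfProj_smul_smul hc]; module

theorem hopfChristoffel_sub_swap (p u v : V) :
    hopfChristoffel p u v - hopfChristoffel p v u = hopfTorsion p u v := by
  simp only [hopfChristoffel, hopfTorsion]; module

/-- The real part of `hopfForm p (hopfTorsion p u v) w` is totally skew-symmetric. -/
theorem hopfForm_hopfTorsion_skew (p u v w : V) :
    (hopfForm p (hopfTorsion p u v) w).re = -(hopfForm p (hopfTorsion p u w) v).re := by
  -- With ω = Im h and θ = Im h(p,·), the left side is 2(ω(u,v)θ(w) + ω(v,w)θ(u) + ω(w,u)θ(v)),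
  -- which is alternating. Ordering the arguments by conjugate symmetry leaves an identity of real
  -- and imaginary parts.
  have h : ∀ a b : V, hopfForm p a b = (starRingEnd ℂ) (hopfForm p b a) :=
    fun a b ↦ (hopfForm_conj p b a).symm
  simp only [hopfTorsion, hopfForm_add_left, hopfForm_smul_left, map_sub, hopfForm_conj]
  rw [h v u, h w u, h w v, h v p, h w p, h u p]
  simp
  ring

/-- The terms h(u,v)p − h(p,v)u form a skew-Hermitian endomorphism of v and drop out; only −h(u,p)v
contributes. What remains is h(v,w) times the logarithmic derivative of |p|⁻² along u, exactly the
variation of the conformal factor. -/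
theorem hopfForm_hopfChristoffel_add (p u v w : V) :
    hopfForm p (hopfChristoffel p u v) w + hopfForm p v (hopfChristoffel p u w) =
      -(hopfForm p p u + hopfForm p u p) * hopfForm p v w := by
  simp only [hopfChristoffel, hopfForm_sub_left, hopfForm_sub_right, hopfForm_smul_left,
    hopfForm_smul_right, hopfForm_conj]
  ring

/-! ### Leibniz rules for the form and the covariant derivative -/

theorem DifferentiableAt.hopfForm {F G : V → V} (hp : p ≠ 0)
    (hF : DifferentiableAt ℝ F p) (hG : DifferentiableAt ℝ G p) :
    DifferentiableAt ℝ (fun x ↦ hopfForm x (F x) (G x)) p :=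
  DifferentiableAt.mul
    (DifferentiableAt.inv (differentiableAt_id.inner ℂ differentiableAt_id)
      (inner_self_ne_zero.2 hp)) (hF.inner ℂ hG)

theorem DifferentiableAt.hopfForm_smul {F G K : V → V} (hp : p ≠ 0)
    (hF : DifferentiableAt ℝ F p) (hG : DifferentiableAt ℝ G p) (hK : DifferentiableAt ℝ K p) :
    DifferentiableAt ℝ (fun x ↦ _root_.hopfForm x (F x) (G x) • K x) p :=
  (DifferentiableAt.hopfForm hp hF hG).smul hK

theorem fderiv_hopfForm {F G : V → V} (hp : p ≠ 0) (hF : DifferentiableAt ℝ F p)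
    (hG : DifferentiableAt ℝ G p) (v : V) :
    fderiv ℝ (fun x ↦ hopfForm x (F x) (G x)) p v =
      hopfForm p (fderiv ℝ F p v) (G p) + hopfForm p (F p) (fderiv ℝ G p v)
        - (hopfForm p p v + hopfForm p v p) * hopfForm p (F p) (G p) := by
  have h0 := (inner_self_ne_zero (𝕜 := ℂ)).2 hp
  have hid : DifferentiableAt ℝ (fun x : V ↦ x) p := differentiableAt_id
  have h1 : HasFDerivAt (fun x : V ↦ (inner ℂ x x : ℂ)) _ p := (hid.inner ℂ hid).hasFDerivAt
  have h2 : HasFDerivAt (fun x : V ↦ (inner ℂ (F x) (G x) : ℂ)) _ p :=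
    (hF.inner ℂ hG).hasFDerivAt
  have h3 := (HasFDerivAt.comp (f := fun x : V ↦ (inner ℂ x x : ℂ)) p
    (hasFDerivAt_inv' (𝕜 := ℝ) h0) h1).mul h2
  have h4 := h3.fderiv
  have e : (fun x ↦ hopfForm x (F x) (G x)) =
    (Inv.inv ∘ fun x : V ↦ (inner ℂ x x : ℂ)) * fun x ↦ inner ℂ (F x) (G x) := rfl
  rw [e, h4]
  -- ⟨p,p⟩ must stay a single atom, so that `h0` can clear the denominators.
  simp [-inner_self_eq_norm_sq_to_K, fderiv_inner_apply ℂ hF hG, fderiv_inner_apply ℂ hid hid, hopfForm]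
  field_simp
  ring

/-- The complex form h itself is parallel, hence so are the metric and Im h: the derivative of
1/|x|² is supplied by `hopfForm_hopfChristoffel_add`. -/
theorem fderiv_hopfForm_eq_hopfCov {F G : V → V} (hp : p ≠ 0) (hF : DifferentiableAt ℝ F p)
    (hG : DifferentiableAt ℝ G p) (v : V) :
    fderiv ℝ (fun x ↦ hopfForm x (F x) (G x)) p v =
      hopfForm p (hopfCov F p v) (G p) + hopfForm p (F p) (hopfCov G p v) := by
  rw [fderiv_hopfForm hp hF hG]
  have := hopfForm_hopfChristoffel_add p v (F p) (G p)
  simp only [hopfCov, hopfForm_add_left, hopfForm_add_right]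
  linear_combination -this

theorem hopfChristoffel_add_right (p u v w : V) :
    hopfChristoffel p u (v + w) = hopfChristoffel p u v + hopfChristoffel p u w := by
  simp only [hopfChristoffel, hopfForm_add_right]; module

theorem hopfChristoffel_smul_right (p u v : V) (c : ℂ) :
    hopfChristoffel p u (c • v) = c • hopfChristoffel p u v := by
  simp only [hopfChristoffel, hopfForm_smul_right]; module

theorem hopfCov_add {F G : V → V} (hF : DifferentiableAt ℝ F p)
    (hG : DifferentiableAt ℝ G p) (v : V) :
    hopfCov (fun x ↦ F x + G x) p v = hopfCov F p v + hopfCov G p v := by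
  simp only [hopfCov, fderiv_fun_add hF hG, hopfChristoffel_add_right, add_apply]
  module

theorem hopfCov_smul {f : V → ℂ} {F : V → V} (hf : DifferentiableAt ℝ f p)
    (hF : DifferentiableAt ℝ F p) (v : V) :
    hopfCov (fun x ↦ f x • F x) p v = f p • hopfCov F p v + fderiv ℝ f p v • F p := by
  simp only [hopfCov, fderiv_fun_smul hf hF, hopfChristoffel_smul_right]
  simp
  module

theorem hopfCov_sub {F G : V → V} (hF : DifferentiableAt ℝ F p)
    (hG : DifferentiableAt ℝ G p) (v : V) :
    hopfCov (fun x ↦ F x - G x) p v = hopfCov F p v - hopfCov G p v := by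
  have h : hopfChristoffel p v (F p - G p) =
      hopfChristoffel p v (F p) - hopfChristoffel p v (G p) := by
    simp only [hopfChristoffel, hopfForm_sub_right]; module
  simp only [hopfCov, fderiv_fun_sub hF hG, h, sub_apply]
  module

/-- Since h_p(p,p) = 1, Γ_p(v,p) = −v cancels the derivative v of the identity. -/
theorem hopfCov_id (hp : p ≠ 0) (v : V) : hopfCov (fun x ↦ x) p v = 0 := by
  simp [hopfCov, hopfChristoffel, hopfForm_self hp]

/-! ### Parallelism of the projection, the torsion and the curvature -/

section Parallel

variable {X Y Z : V → V}

theorem DifferentiableAt.hopfTorsion (hp : p ≠ 0) (hX : DifferentiableAt ℝ X p)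
    (hY : DifferentiableAt ℝ Y p) : DifferentiableAt ℝ (fun x ↦ hopfTorsion x (X x) (Y x)) p := by
  have hid : DifferentiableAt ℝ (fun x : V ↦ x) p := differentiableAt_id
  have H {F G : V → V} := DifferentiableAt.hopfForm (F := F) (G := G) hp
  exact ((((H hX hY).sub (H hY hX)).smul hid).add (((H hY hid).sub (H hid hY)).smul hX)).add
    (((H hid hX).sub (H hX hid)).smul hY)

theorem DifferentiableAt.hopfProj (hp : p ≠ 0) (hX : DifferentiableAt ℝ X p) :
    DifferentiableAt ℝ (fun x ↦ hopfProj x (X x)) p :=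
  have hid : DifferentiableAt ℝ (fun x : V ↦ x) p := differentiableAt_id
  hX.sub (DifferentiableAt.hopfForm_smul hp hid hX hid)

theorem DifferentiableAt.hopfCurvature (hp : p ≠ 0) (hX : DifferentiableAt ℝ X p)
    (hY : DifferentiableAt ℝ Y p) (hZ : DifferentiableAt ℝ Z p) :
    DifferentiableAt ℝ (fun x ↦ hopfCurvature x (X x) (Y x) (Z x)) p := by
  have hid : DifferentiableAt ℝ (fun x : V ↦ x) p := differentiableAt_id
  have H {F G : V → V} := DifferentiableAt.hopfForm (F := F) (G := G) hp
  have hX' := hX.hopfProj hp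
  have hY' := hY.hopfProj hp
  have hZ' := hZ.hopfProj hp
  exact ((((H hX' hY').sub (H hY' hX')).smul hZ').add ((H hY' hZ').smul hX')).sub
    ((H hX' hZ').smul hY')

/-- Torsion and curvature are sums of terms h(F,G)K. With h parallel, each such term obeys a
threefold Leibniz rule, and entries equal to the position field contribute nothing. -/
theorem hopfCov_hopfForm_smul {F G K : V → V} (hp : p ≠ 0) (hF : DifferentiableAt ℝ F p)
    (hG : DifferentiableAt ℝ G p) (hK : DifferentiableAt ℝ K p) (v : V) :
    hopfCov (fun x ↦ hopfForm x (F x) (G x) • K x) p v =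
      hopfForm p (hopfCov F p v) (G p) • K p + hopfForm p (F p) (hopfCov G p v) • K p
        + hopfForm p (F p) (G p) • hopfCov K p v := by
  rw [hopfCov_smul (DifferentiableAt.hopfForm hp hF hG) hK,
    fderiv_hopfForm_eq_hopfCov hp hF hG]
  module

theorem hopfCov_hopfProj (hp : p ≠ 0) (hX : DifferentiableAt ℝ X p) (v : V) :
    hopfCov (fun x ↦ hopfProj x (X x)) p v = hopfProj p (hopfCov X p v) := by
  have hid : DifferentiableAt ℝ (fun x : V ↦ x) p := differentiableAt_id
  simp only [hopfProj]
  rw [hopfCov_sub hX (.hopfForm_smul hp hid hX hid), hopfCov_hopfForm_smul hp hid hX hid, hopfCov_id hp]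
  simp [hopfForm]

theorem hopfCov_hopfTorsion (hp : p ≠ 0) (hX : DifferentiableAt ℝ X p)
    (hY : DifferentiableAt ℝ Y p) (v : V) :
    hopfCov (fun x ↦ hopfTorsion x (X x) (Y x)) p v =
      hopfTorsion p (hopfCov X p v) (Y p) + hopfTorsion p (X p) (hopfCov Y p v) := by
  have hid : DifferentiableAt ℝ (fun x : V ↦ x) p := differentiableAt_id
  have H {F G K : V → V} (hF : DifferentiableAt ℝ F p) (hG : DifferentiableAt ℝ G p)
    (hK : DifferentiableAt ℝ K p) := DifferentiableAt.hopfForm_smul hp hF hG hK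
  have S {F G K : V → V} (hF : DifferentiableAt ℝ F p) (hG : DifferentiableAt ℝ G p)
    (hK : DifferentiableAt ℝ K p) := hopfCov_hopfForm_smul hp hF hG hK v
  simp only [hopfTorsion, sub_smul]
  rw [hopfCov_add, hopfCov_add, hopfCov_sub, hopfCov_sub, hopfCov_sub]
  · rw [S hX hY hid, S hY hX hid, S hY hid hX, S hid hY hX, S hid hX hY, S hX hid hY,
      hopfCov_id hp]
    simp only [hopfForm, inner_zero_left, inner_zero_right]
    module
  all_goals first
    | exact H hX hY hid | exact H hY hX hid | exact H hY hid hX | exact H hid hY hX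
    | exact H hid hX hY | exact H hX hid hY
    | exact (H hX hY hid).sub (H hY hX hid) | exact (H hY hid hX).sub (H hid hY hX)
    | exact (H hid hX hY).sub (H hX hid hY)
    | exact ((H hX hY hid).sub (H hY hX hid)).add ((H hY hid hX).sub (H hid hY hX))

theorem hopfCov_hopfCurvature (hp : p ≠ 0) (hX : DifferentiableAt ℝ X p)
    (hY : DifferentiableAt ℝ Y p) (hZ : DifferentiableAt ℝ Z p) (v : V) :
    hopfCov (fun x ↦ hopfCurvature x (X x) (Y x) (Z x)) p v =
      hopfCurvature p (hopfCov X p v) (Y p) (Z p) + hopfCurvature p (X p) (hopfCov Y p v) (Z p)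
        + hopfCurvature p (X p) (Y p) (hopfCov Z p v) := by
  have hid : DifferentiableAt ℝ (fun x : V ↦ x) p := differentiableAt_id
  have H {F G K : V → V} (hF : DifferentiableAt ℝ F p) (hG : DifferentiableAt ℝ G p)
    (hK : DifferentiableAt ℝ K p) := DifferentiableAt.hopfForm_smul hp hF hG hK
  have S {F G K : V → V} (hF : DifferentiableAt ℝ F p) (hG : DifferentiableAt ℝ G p)
    (hK : DifferentiableAt ℝ K p) := hopfCov_hopfForm_smul hp hF hG hK v
  have hX' := hX.hopfProj hp
  have hY' := hY.hopfProj hp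
  have hZ' := hZ.hopfProj hp
  simp only [hopfCurvature, sub_smul]
  rw [hopfCov_sub, hopfCov_add, hopfCov_sub]
  · rw [S hX' hY' hZ', S hY' hX' hZ', S hY' hZ' hX', S hX' hZ' hY', hopfCov_hopfProj hp hX,
      hopfCov_hopfProj hp hY, hopfCov_hopfProj hp hZ]
    module
  all_goals first
    | exact H hX' hY' hZ' | exact H hY' hX' hZ' | exact H hY' hZ' hX' | exact H hX' hZ' hY'
    | exact (H hX' hY' hZ').sub (H hY' hX' hZ')
    | exact ((H hX' hY' hZ').sub (H hY' hX' hZ')).add (H hY' hZ' hX')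

end Parallel

/-- For constant fields `u`, `v`, `w` the curvature is `∇_u ∇_v w - ∇_v ∇_u w`. -/
theorem hopfCov_hopfCov_sub (hp : p ≠ 0) (u v w : V) :
    hopfCov (fun x ↦ hopfChristoffel x v w) p u - hopfCov (fun x ↦ hopfChristoffel x u w) p v =
      hopfCurvature p u v w := by
  have hid : DifferentiableAt ℝ (fun x : V ↦ x) p := differentiableAt_id
  have hc (u : V) : DifferentiableAt ℝ (fun _ : V ↦ u) p := differentiableAt_const u
  -- The Leibniz rule applied to the three terms of Γ(v,w): a constant field v has ∇_u v = Γ(u,v),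
  -- and the derivative of the position field vanishes.
  have key (u v : V) : hopfCov (fun x ↦ hopfChristoffel x v w) p u =
      hopfForm p (hopfChristoffel p u v) w • p + hopfForm p v (hopfChristoffel p u w) • p
        - (hopfForm p p (hopfChristoffel p u w) • v + hopfForm p p w • hopfChristoffel p u v)
        - (hopfForm p (hopfChristoffel p u v) p • w + hopfForm p v p • hopfChristoffel p u w) := by
    have H {F G K : V → V} (hF : DifferentiableAt ℝ F p) (hG : DifferentiableAt ℝ G p)
      (hK : DifferentiableAt ℝ K p) := DifferentiableAt.hopfForm_smul hp hF hG hK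
    have c (u v : V) : hopfCov (fun _ ↦ v) p u = hopfChristoffel p u v := by simp [hopfCov]
    have e : (fun x ↦ hopfChristoffel x v w) = fun x ↦ hopfForm x v w • x - hopfForm x x w • v
      - hopfForm x v x • w := rfl
    rw [e, hopfCov_sub ((H (hc v) (hc w) hid).fun_sub (H hid (hc w) (hc v))) (H (hc v) hid (hc w)),
      hopfCov_sub (H (hc v) (hc w) hid) (H hid (hc w) (hc v)),
      hopfCov_hopfForm_smul hp (hc v) (hc w) hid, hopfCov_hopfForm_smul hp hid (hc w) (hc v),
      hopfCov_hopfForm_smul hp (hc v) hid (hc w), hopfCov_id hp, c, c]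
    simp [hopfForm]
  rw [key, key]
  simp only [hopfCurvature, hopfProj, hopfChristoffel, hopfForm_sub_left, hopfForm_sub_right,
    hopfForm_smul_left, hopfForm_smul_right, hopfForm_conj, hopfForm_self hp]
  match_scalars <;> ring

end Cone

/-! ## Coordinate representatives of vector fields on the Hopf manifold -/

section HopfField

variable {V : Type*} [NormedAddCommGroup V] [InnerProductSpace ℂ V] [FiniteDimensional ℂ V]

namespace Hopf

theorem chart_ne_zero {x y : Hopf V} (hy : y ∈ (chartAt V x).source) : chartAt V x y ≠ 0 :=
  (chart_spec (chart_mem_atlas V x) hy).1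

theorem chart_self_ne_zero (x : Hopf V) : chartAt V x x ≠ 0 :=
  chart_ne_zero (mem_chart_source V x)

/-- The representative of the vector field `Y` in the chart at `x`. -/
def rep (Y : Hopf V → V) (x : Hopf V) (p : V) : V :=
  ((‖p‖ / ‖chartAt V ((chartAt V x).symm p) ((chartAt V x).symm p)‖ : ℝ) : ℂ) •
    Y ((chartAt V x).symm p)

/-- The constant c is a power of 2. Being a positive real, it is determined by the norms of the two
coordinates, so the norm ratio names c⁻¹ without choosing an exponent. -/
theorem exists_transition {x y : Hopf V} (hy : y ∈ (chartAt V x).source) :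
    ∃ c : ℂ, c ≠ 0 ∧ chartAt V y y = c • chartAt V x y ∧
      ((‖chartAt V x y‖ / ‖chartAt V y y‖ : ℝ) : ℂ) = c⁻¹ ∧
      (∀ᶠ w in nhds (chartAt V x y), chartAt V y ((chartAt V x).symm w) = c • w) ∧
      (‖c‖ : ℂ) = c := by
  obtain ⟨k, hk⟩ := transition (chart_mem_atlas V x) (chart_mem_atlas V y) hy
    (mem_chart_source V y)
  have h := hk.self_of_nhds
  rw [OpenPartialHomeomorph.left_inv _ hy] at h
  refine ⟨2 ^ k, zpow_ne_zero _ two_ne_zero, h, ?_, hk, by simp⟩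
  have h0 : ‖chartAt V x y‖ ≠ 0 := norm_ne_zero_iff.2 (chart_ne_zero hy)
  rw [h, norm_smul, norm_two_zpow]
  have h2 : (2 : ℝ) ^ k ≠ 0 := by positivity
  rw [show ‖chartAt V x y‖ / (2 ^ k * ‖chartAt V x y‖) = ((2 : ℝ) ^ k)⁻¹ by field_simp]
  push_cast
  rfl

/-- Near y the coordinate change from the chart at y to the chart at x is multiplication by a
constant, which is therefore its derivative too. This explains the norm ratio in `rep`: the fibre
over y is read in the chart at y, the representative in the chart at x. -/
theorem trivializationAt_snd {x y : Hopf V} (hy : y ∈ (chartAt V x).source)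
    (v : V) :
    (trivializationAt V (TangentSpace 𝓘(ℝ, V)) x ⟨y, v⟩).2 =
      ((‖chartAt V x y‖ / ‖chartAt V y y‖ : ℝ) : ℂ) • v := by
  obtain ⟨k, hk⟩ := transition (chart_mem_atlas V y) (chart_mem_atlas V x) (mem_chart_source V y) hy
  have h := hk.self_of_nhds
  rw [OpenPartialHomeomorph.left_inv _ (mem_chart_source V y)] at h
  have h0 : ‖chartAt V y y‖ ≠ 0 := norm_ne_zero_iff.2 (chart_self_ne_zero y)
  rw [h, norm_smul, norm_two_zpow, mul_div_cancel_right₀ _ h0, TangentBundle.trivializationAt_apply]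
  simp only [mfld_simps, fderivWithin_univ]
  have h : HasFDerivAt (fun w : V ↦ (2 : ℂ) ^ k • w)
      ((2 : ℂ) ^ k • ContinuousLinearMap.id ℝ V) (chartAt V y y) :=
    ((2 : ℂ) ^ k • ContinuousLinearMap.id ℝ V).hasFDerivAt
  have h' := h.congr_of_eventuallyEq (f₁ := chartAt V x ∘ (chartAt V y).symm) hk
  rw [h'.fderiv]
  push_cast
  rfl

variable (Y : Hopf V → V)

theorem rep_chart {x y : Hopf V} (hy : y ∈ (chartAt V x).source) :
    rep Y x (chartAt V x y) = ((‖chartAt V x y‖ / ‖chartAt V y y‖ : ℝ) : ℂ) • Y y := by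
  rw [rep, OpenPartialHomeomorph.left_inv _ hy]

theorem rep_self (x : Hopf V) : rep Y x (chartAt V x x) = Y x := by
  rw [rep_chart Y (mem_chart_source V x), div_self (norm_ne_zero_iff.2 (chart_self_ne_zero x))]
  simp

/-- This is the push-forward of a vector field along w ↦ c • w. Positivity of c enters through
`hc'`, because the factor in `rep` only detects ‖c‖. -/
theorem rep_change {x y : Hopf V} (hy : y ∈ (chartAt V x).source) {c : ℂ} (hc : c ≠ 0)
    (hc' : (‖c‖ : ℂ) = c) (h0 : chartAt V y y = c • chartAt V x y)
    (h : ∀ᶠ w in nhds (chartAt V x y), chartAt V y ((chartAt V x).symm w) = c • w) :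
    rep Y y =ᶠ[nhds (chartAt V y y)] fun p ↦ c • rep Y x (c⁻¹ • p) := by
  have hcont : Filter.Tendsto (fun p : V ↦ c⁻¹ • p) (nhds (chartAt V y y))
      (nhds (chartAt V x y)) := by
    have : ContinuousAt (fun p : V ↦ c⁻¹ • p) (chartAt V y y) := by fun_prop
    have h1 := this.tendsto
    rwa [h0, inv_smul_smul₀ hc, ← h0] at h1
  have hsrc : ∀ᶠ w in nhds (chartAt V x y), (chartAt V x).symm w ∈ (chartAt V y).source := by
    refine ((chartAt V x).continuousAt_symm ((chartAt V x).map_source hy)).preimage_mem_nhds ?_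
    rw [OpenPartialHomeomorph.left_inv _ hy]
    exact (chartAt V y).open_source.mem_nhds (mem_chart_source V y)
  filter_upwards [hcont.eventually h, hcont.eventually hsrc] with p hp hp'
  have e : (chartAt V y).symm p = (chartAt V x).symm (c⁻¹ • p) := by
    rw [← (chartAt V y).left_inv hp', hp, smul_inv_smul₀ hc]
  rw [rep, rep, e, smul_smul]
  congr 1
  rw [norm_smul, norm_inv]
  push_cast
  rw [hc']
  field_simp

theorem eventually_rep_eq {x y : Hopf V} (hy : y ∈ (chartAt V x).source) :
    (fun z ↦ (trivializationAt V (TangentSpace 𝓘(ℝ, V)) x ⟨z, Y z⟩).2) =ᶠ[nhds y]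
      rep Y x ∘ chartAt V x := by
  filter_upwards [(chartAt V x).open_source.mem_nhds hy] with z hz
  rw [trivializationAt_snd hz, Function.comp, rep_chart Y hz]

/-! ### Differentiability and derivatives read in a preferred chart -/

section

variable {F : Type*} [NormedAddCommGroup F] [NormedSpace ℝ F] {n : ℕ∞ω}

theorem contMDiffAt_chart {x y : Hopf V} (hy : y ∈ (chartAt V x).source) :
    ContMDiffAt 𝓘(ℝ, V) 𝓘(ℝ, V) ω (chartAt V x) y :=
  contMDiffAt_of_mem_maximalAtlas (IsManifold.chart_mem_maximalAtlas x) hy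

theorem contMDiffAt_chart_symm {x y : Hopf V} (hy : y ∈ (chartAt V x).source) :
    ContMDiffAt 𝓘(ℝ, V) 𝓘(ℝ, V) ω (chartAt V x).symm (chartAt V x y) :=
  contMDiffAt_symm_of_mem_maximalAtlas (IsManifold.chart_mem_maximalAtlas x)
    ((chartAt V x).map_source hy)

theorem mdifferentiableAt_comp_chart_iff {f : V → F} {x y : Hopf V}
    (hy : y ∈ (chartAt V x).source) :
    MDifferentiableAt 𝓘(ℝ, V) 𝓘(ℝ, F) (f ∘ chartAt V x) y ↔
      DifferentiableAt ℝ f (chartAt V x y) := by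
  refine ⟨fun h ↦ ?_, fun h ↦ h.mdifferentiableAt.comp y
    ((contMDiffAt_chart hy).mdifferentiableAt (by simp))⟩
  have h1 : MDifferentiableAt 𝓘(ℝ, V) 𝓘(ℝ, F) ((f ∘ chartAt V x) ∘ (chartAt V x).symm)
      (chartAt V x y) := by
    refine MDifferentiableAt.comp (I' := 𝓘(ℝ, V)) _ ?_
      ((contMDiffAt_chart_symm hy).mdifferentiableAt (by simp))
    rwa [OpenPartialHomeomorph.left_inv _ hy]
  refine (mdifferentiableAt_iff_differentiableAt.1 h1).congr_of_eventuallyEq ?_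
  filter_upwards [(chartAt V x).open_target.mem_nhds ((chartAt V x).map_source hy)] with w hw
  simp [(chartAt V x).right_inv hw]

theorem contMDiffAt_comp_chart_iff {f : V → F} {x y : Hopf V}
    (hy : y ∈ (chartAt V x).source) :
    ContMDiffAt 𝓘(ℝ, V) 𝓘(ℝ, F) n (f ∘ chartAt V x) y ↔
      ContDiffAt ℝ n f (chartAt V x y) := by
  refine ⟨fun h ↦ ?_, fun h ↦ h.contMDiffAt.comp y
    ((contMDiffAt_chart hy).of_le le_top)⟩
  have h1 : ContMDiffAt 𝓘(ℝ, V) 𝓘(ℝ, F) n ((f ∘ chartAt V x) ∘ (chartAt V x).symm)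
      (chartAt V x y) := by
    refine ContMDiffAt.comp (I' := 𝓘(ℝ, V)) _ ?_
      ((contMDiffAt_chart_symm hy).of_le le_top)
    rwa [OpenPartialHomeomorph.left_inv _ hy]
  refine (contMDiffAt_iff_contDiffAt.1 h1).congr_of_eventuallyEq ?_
  filter_upwards [(chartAt V x).open_target.mem_nhds ((chartAt V x).map_source hy)] with w hw
  simp [(chartAt V x).right_inv hw]

theorem mfderiv_comp_chart {f : V → F} {x : Hopf V} (hf : DifferentiableAt ℝ f (chartAt V x x))
    (v : V) :
    mfderiv 𝓘(ℝ, V) 𝓘(ℝ, F) (f ∘ chartAt V x) x v = fderiv ℝ f (chartAt V x x) v := by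
  have h := (mdifferentiableAt_comp_chart_iff (mem_chart_source V x)).2 hf
  rw [h.mfderiv]
  simp only [writtenInExtChartAt, mfld_simps, fderivWithin_univ]
  refine congrArg (fun L : V →L[ℝ] F ↦ L v) (Filter.EventuallyEq.fderiv_eq ?_)
  filter_upwards [(chartAt V x).open_target.mem_nhds (mem_chart_target V x)] with w hw
  simp [(chartAt V x).right_inv hw, chartAt_self_eq]

end

variable {Y}

theorem differentiableFieldAt_iff {x y : Hopf V} (hy : y ∈ (chartAt V x).source) :
    DifferentiableFieldAt Y y ↔ DifferentiableAt ℝ (rep Y x) (chartAt V x y) := by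
  rw [← mdifferentiableAt_comp_chart_iff hy,
    ← (eventually_rep_eq Y hy).mdifferentiableAt_iff]
  exact Bundle.Trivialization.mdifferentiableAt_section_iff 𝓘(ℝ, V)
    (trivializationAt V (TangentSpace 𝓘(ℝ, V)) x) Y hy

theorem differentiableFieldAt_iff_self {x : Hopf V} :
    DifferentiableFieldAt Y x ↔ DifferentiableAt ℝ (rep Y x) (chartAt V x x) :=
  differentiableFieldAt_iff (mem_chart_source V x)

theorem contDiffAt_rep {n : ℕ∞ω} {x : Hopf V}
    (h : ContMDiffAt 𝓘(ℝ, V) 𝓘(ℝ, V).tangent n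
      (fun y ↦ (⟨y, Y y⟩ : TangentBundle 𝓘(ℝ, V) (Hopf V))) x) :
    ContDiffAt ℝ n (rep Y x) (chartAt V x x) := by
  rw [← contMDiffAt_comp_chart_iff (mem_chart_source V x)]
  refine ((Bundle.contMDiffAt_section x).1 h).congr_of_eventuallyEq ?_
  exact (eventually_rep_eq Y (mem_chart_source V x)).symm

/-- The extension is constant in the trivialization at x, whose coordinates are those of `rep`.
Hence brackets of two such extensions vanish at x, and the curvature there is a commutator on
constant fields. -/
theorem rep_extendField {x : Hopf V} (u : V) {y : Hopf V}
    (hy : y ∈ (chartAt V x).source) :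
    rep (AffineConnection.extendField (x := x) u) x (chartAt V x y) = u := by
  refine (rep_chart _ hy).trans ((trivializationAt_snd hy _).symm.trans ?_)
  have hx := trivializationAt_snd (mem_chart_source V x) u
  rw [div_self (norm_ne_zero_iff.2 (chart_self_ne_zero x)), Complex.ofReal_one, one_smul] at hx
  have h := Bundle.Trivialization.apply_mk_symm (trivializationAt V (TangentSpace 𝓘(ℝ, V)) x)
    (show y ∈ (trivializationAt V (TangentSpace 𝓘(ℝ, V)) x).baseSet from hy)
    (trivializationAt V (TangentSpace 𝓘(ℝ, V)) x ⟨x, u⟩).2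
  exact (congrArg Prod.snd h).trans hx

theorem eventually_rep_extendField {x : Hopf V} (u : V) {y : Hopf V}
    (hy : y ∈ (chartAt V x).source) :
    rep (AffineConnection.extendField (x := x) u) x =ᶠ[nhds (chartAt V x y)] fun _ ↦ u := by
  filter_upwards [(chartAt V x).open_target.mem_nhds ((chartAt V x).map_source hy)] with w hw
  have h := rep_extendField u ((chartAt V x).map_target hw)
  rwa [(chartAt V x).right_inv hw] at h

theorem mfderiv_extChartAt {x y : Hopf V} (hy : y ∈ (chartAt V x).source) (v : V) :
    mfderiv 𝓘(ℝ, V) 𝓘(ℝ, V) (extChartAt 𝓘(ℝ, V) x) y v =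
      ((‖chartAt V x y‖ / ‖chartAt V y y‖ : ℝ) : ℂ) • v := by
  refine Eq.trans ?_ (trivializationAt_snd hy v)
  rw [← TangentBundle.continuousLinearMapAt_trivializationAt hy]
  exact Bundle.Trivialization.continuousLinearMapAt_apply_of_mem (R := ℝ)
    (trivializationAt V (TangentSpace 𝓘(ℝ, V)) x)
    (show y ∈ (trivializationAt V (TangentSpace 𝓘(ℝ, V)) x).baseSet from hy) v

theorem mpullbackWithin_extChartAt_symm (Z : (x : Hopf V) → TangentSpace 𝓘(ℝ, V) x) {x : Hopf V}
    {w : V} (hw : w ∈ (chartAt V x).target) :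
    VectorField.mpullbackWithin 𝓘(ℝ, V) 𝓘(ℝ, V) (extChartAt 𝓘(ℝ, V) x).symm Z
      (Set.range 𝓘(ℝ, V)) w = rep Z x w := by
  rw [VectorField.mpullbackWithin_apply]
  have hw' : w ∈ (extChartAt 𝓘(ℝ, V) x).target := by simpa using hw
  have h1 := isInvertible_mfderivWithin_extChartAt_symm hw'
  have h2 := mfderivWithin_extChartAt_symm_comp_mfderiv_extChartAt hw'
  have h3 := mfderiv_extChartAt ((chartAt V x).map_target hw) (Z ((chartAt V x).symm w))
  rw [(chartAt V x).right_inv hw] at h3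
  refine (h1.inverse_apply_eq).2 ((DFunLike.congr_fun h2 (Z ((chartAt V x).symm w))).symm.trans ?_)
  exact congrArg (mfderivWithin 𝓘(ℝ, V) 𝓘(ℝ, V) (extChartAt 𝓘(ℝ, V) x).symm
    (Set.range 𝓘(ℝ, V)) w) h3

/-- The bracket is computed after pulling back by the inverse chart, which turns X and Y into their
representatives; at the base point the derivative of the chart is the identity. -/
theorem mlieBracket_eq (X Y : (x : Hopf V) → TangentSpace 𝓘(ℝ, V) x) (x : Hopf V) :
    VectorField.mlieBracket 𝓘(ℝ, V) X Y x =
      fderiv ℝ (rep Y x) (chartAt V x x) (X x) - fderiv ℝ (rep X x) (chartAt V x x) (Y x) := by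
  have key (Z : (x : Hopf V) → TangentSpace 𝓘(ℝ, V) x) :
      (VectorField.mpullbackWithin 𝓘(ℝ, V) 𝓘(ℝ, V) (extChartAt 𝓘(ℝ, V) x).symm Z
        (Set.range 𝓘(ℝ, V)) : V → V) =ᶠ[nhds (chartAt V x x)] rep Z x := by
    filter_upwards [(chartAt V x).open_target.mem_nhds (mem_chart_target V x)] with w hw
    exact mpullbackWithin_extChartAt_symm Z hw
  rw [← VectorField.mlieBracketWithin_univ, VectorField.mlieBracketWithin_apply,
    mfderiv_extChartAt_self]
  have e {A B F G : V → V} {s : Set V} {p : V} (hs : s = Set.univ) (hA : A =ᶠ[nhds p] F)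
      (hB : B =ᶠ[nhds p] G) : VectorField.lieBracketWithin ℝ A B s p =
        fderiv ℝ G p (F p) - fderiv ℝ F p (G p) := by
    rw [hs, VectorField.lieBracketWithin_univ, hA.lieBracket_vectorField_eq hB,
      VectorField.lieBracket]
  refine Eq.trans ?_ ((e (s := (extChartAt 𝓘(ℝ, V) x).symm ⁻¹' Set.univ ∩ Set.range 𝓘(ℝ, V))
    (by simp) (key X) (key Y)).trans (congrArg₂ (fun a b ↦ fderiv ℝ (rep Y x) (chartAt V x x) a
      - fderiv ℝ (rep X x) (chartAt V x x) b) (rep_self X x) (rep_self Y x)))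
  exact DFunLike.congr_fun (ContinuousLinearMap.inverse_id (R := ℝ) (M := V)) _

end Hopf

end HopfField

/-! ## The Bismut connection of the Hopf manifold -/

section HopfConnection

variable {V : Type*} [NormedAddCommGroup V] [InnerProductSpace ℂ V] [FiniteDimensional ℂ V]

/-- `u ↦ hopfChristoffel p u w` as a continuous real linear map. -/
def hopfChristoffelL (p w : V) : V →L[ℝ] V :=
  LinearMap.toContinuousLinearMap
    { toFun u := hopfChristoffel p u w
      map_add' u v := by
        simp only [hopfChristoffel, hopfForm_add_left]; module
      map_smul' a u := by
        simp only [hopfChristoffel, ← Complex.coe_smul, hopfForm_smul_left, Complex.conj_ofReal,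
          RingHom.id_apply]
        module }

theorem hopfChristoffelL_add (p w w' : V) :
    hopfChristoffelL p (w + w') = hopfChristoffelL p w + hopfChristoffelL p w' := by
  ext u; exact hopfChristoffel_add_right p u w w'

theorem hopfChristoffelL_smul (p w : V) (a : ℝ) :
    hopfChristoffelL p (a • w) = a • hopfChristoffelL p w := by
  ext u
  refine (congrArg (hopfChristoffel p u) (Complex.coe_smul a w).symm).trans
    ((hopfChristoffel_smul_right p u w a).trans (Complex.coe_smul a _))

namespace Hopf

theorem ratio_ne_zero {x y : Hopf V} (hy : y ∈ (chartAt V x).source) :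
    ((‖chartAt V x y‖ / ‖chartAt V y y‖ : ℝ) : ℂ) ≠ 0 :=
  Complex.ofReal_ne_zero.2 (div_ne_zero (norm_ne_zero_iff.2 (chart_ne_zero hy))
    (norm_ne_zero_iff.2 (chart_self_ne_zero y)))

theorem ratio_smul_chart {x y : Hopf V} (hy : y ∈ (chartAt V x).source) :
    ((‖chartAt V x y‖ / ‖chartAt V y y‖ : ℝ) : ℂ) • chartAt V y y = chartAt V x y := by
  obtain ⟨c, hc, h1, h2, -⟩ := exists_transition hy
  rw [h2, h1, inv_smul_smul₀ hc]

theorem rep_add (Y Z : Hopf V → V) (x : Hopf V) :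
    rep (Y + Z) x = fun p ↦ rep Y x p + rep Z x p := by
  ext p; simp [rep]

theorem rep_smul (f : Hopf V → ℝ) (Y : Hopf V → V) (x : Hopf V) :
    rep (fun y ↦ f y • Y y) x = fun p ↦ (f ((chartAt V x).symm p)) • rep Y x p := by
  ext p; simp only [rep]; exact smul_comm _ _ _

theorem eventually_comp_chart_symm {α : Type*} (f : Hopf V → α) (x : Hopf V) :
    f =ᶠ[nhds x] (f ∘ (chartAt V x).symm) ∘ chartAt V x := by
  filter_upwards [(chartAt V x).open_source.mem_nhds (mem_chart_source V x)] with y hy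
  simp [(chartAt V x).left_inv hy]

variable (V) in
/-- The Bismut connection of the Hopf manifold. -/
def connection : AffineConnection V (Hopf V) where
  toFun Y x :=
    (fderiv ℝ (rep Y x) (chartAt V x x) + hopfChristoffelL (chartAt V x x) (Y x) : V →L[ℝ] V)
  isCovariantDerivativeOnUniv :=
    { add := by
        intro Y Z x hY hZ _
        have hY' := differentiableFieldAt_iff_self.1 hY
        have hZ' := differentiableFieldAt_iff_self.1 hZ
        have h1 : fderiv ℝ (rep (Y + Z) x) (chartAt V x x) =
            fderiv ℝ (rep Y x) (chartAt V x x) + fderiv ℝ (rep Z x) (chartAt V x x) :=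
          (congrArg (fun F ↦ fderiv ℝ F (chartAt V x x)) (rep_add Y Z x)).trans
            (fderiv_fun_add hY' hZ')
        exact (congrArg₂ (· + ·) h1 (hopfChristoffelL_add (chartAt V x x) (Y x) (Z x))).trans
          (add_add_add_comm _ _ _ _)
      leibniz := by
        intro Y f x hY hf _
        have hY' := differentiableFieldAt_iff_self.1 hY
        have hf' : DifferentiableAt ℝ (f ∘ (chartAt V x).symm) (chartAt V x x) :=
          (mdifferentiableAt_comp_chart_iff (mem_chart_source V x)).1
            ((eventually_comp_chart_symm f x).mdifferentiableAt_iff.1 hf)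
        have hd (v : V) : fderiv ℝ (f ∘ (chartAt V x).symm) (chartAt V x x) v =
            mfderiv 𝓘(ℝ, V) 𝓘(ℝ, ℝ) f x v := by
          rw [(eventually_comp_chart_symm f x).mfderiv_eq]
          exact (mfderiv_comp_chart hf' v).symm
        have h1 : fderiv ℝ (rep (fun y ↦ f y • (Y y : V)) x) (chartAt V x x) = _ :=
          (congrArg (fun F ↦ fderiv ℝ F (chartAt V x x)) (rep_smul f Y x)).trans
            (fderiv_fun_smul hf' hY')
        refine (congrArg₂ (· + ·) h1
          (hopfChristoffelL_smul (chartAt V x x) (Y x) (f x))).trans ?_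
        ext v
        change (f ((chartAt V x).symm (chartAt V x x)) • fderiv ℝ (rep Y x) (chartAt V x x) v
            + (fderiv ℝ (f ∘ (chartAt V x).symm) (chartAt V x x) v) • rep Y x (chartAt V x x))
            + f x • hopfChristoffel (chartAt V x x) v (Y x) =
          f x • (fderiv ℝ (rep Y x) (chartAt V x x) v + hopfChristoffel (chartAt V x x) v (Y x))
            + (show ℝ from mfderiv 𝓘(ℝ, V) 𝓘(ℝ, ℝ) f x v) • (show V from Y x)
        rw [show rep Y x (chartAt V x x) = show V from Y x from rep_self Y x,
          (chartAt V x).left_inv (mem_chart_source V x), show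
            fderiv ℝ (f ∘ (chartAt V x).symm) (chartAt V x x) v =
              show ℝ from mfderiv 𝓘(ℝ, V) 𝓘(ℝ, ℝ) f x v from hd v]
        module }

theorem connection_apply (Y : (x : Hopf V) → TangentSpace 𝓘(ℝ, V) x) (x : Hopf V)
    (v : TangentSpace 𝓘(ℝ, V) x) :
    connection V Y x v = hopfCov (rep Y x) (chartAt V x x) v :=
  congrArg (fun w ↦ fderiv ℝ (rep Y x) (chartAt V x x) v + hopfChristoffel (chartAt V x x) v w)
    (rep_self Y x).symm

/-- At y the connection is defined through the chart at y; here the same formula is recovered in the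
chart at x. The derivative term transforms by the chain rule and `rep_change`, the other by the
homogeneity of Γ. Smoothness and iterated derivatives depend on this. -/
theorem ratio_smul_connection {Y : (x : Hopf V) → TangentSpace 𝓘(ℝ, V) x} {x y : Hopf V}
    (hy : y ∈ (chartAt V x).source) (hY : DifferentiableFieldAt Y y) (v : V) :
    (HSMul.hSMul (β := V) ((‖chartAt V x y‖ / ‖chartAt V y y‖ : ℝ) : ℂ) (connection V Y y v) : V) =
      hopfCov (rep Y x) (chartAt V x y)
        (((‖chartAt V x y‖ / ‖chartAt V y y‖ : ℝ) : ℂ) • v) := by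
  obtain ⟨c, hc, h1, h2, h3, h4⟩ := exists_transition hy
  have hd := (differentiableFieldAt_iff hy).1 hY
  have hr := rep_change Y hy hc h4 h1 h3
  rw [h2]
  have e : hopfCov (rep Y y) (chartAt V y y) v = c • hopfCov (rep Y x) (chartAt V x y) (c⁻¹ • v) := by
    have h5 : c⁻¹ • chartAt V y y = chartAt V x y := by rw [h1, inv_smul_smul₀ hc]
    have hF : HasFDerivAt (fun p : V ↦ c⁻¹ • p) (c⁻¹ • ContinuousLinearMap.id ℝ V)
        (chartAt V y y) := (c⁻¹ • ContinuousLinearMap.id ℝ V).hasFDerivAt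
    have hG : HasFDerivAt (rep Y x) (fderiv ℝ (rep Y x) (chartAt V x y)) (c⁻¹ • chartAt V y y) := by
      rw [h5]; exact hd.hasFDerivAt
    have h6 := ((hG.comp _ hF).const_smul c).congr_of_eventuallyEq hr
    rw [hopfCov, h6.fderiv, hr.eq_of_nhds, hopfCov, h5, smul_add, ← hopfChristoffel_smul_smul hc,
      h1, smul_inv_smul₀ hc]
    rfl
  refine (congrArg (fun w : V ↦ c⁻¹ • w) ((connection_apply Y y v).trans e)).trans ?_
  rw [inv_smul_smul₀ hc]

/-- A second derivative sees the first one at nearby points, so Y must be differentiable on a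
neighbourhood. -/
theorem rep_connection {Y Z : (x : Hopf V) → TangentSpace 𝓘(ℝ, V) x} {x : Hopf V}
    (hY : ∀ᶠ y in nhds x, DifferentiableFieldAt Y y) :
    rep (fun y ↦ connection V Y y (Z y)) x =ᶠ[nhds (chartAt V x x)]
      fun p ↦ hopfCov (rep Y x) p (rep Z x p) := by
  have h1 := ((chartAt V x).continuousAt_symm (mem_chart_target V x))
  rw [ContinuousAt, (chartAt V x).left_inv (mem_chart_source V x)] at h1
  filter_upwards [(chartAt V x).open_target.mem_nhds (mem_chart_target V x), h1.eventually hY]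
    with w hw hw'
  have h := ratio_smul_connection ((chartAt V x).map_target hw) hw' (Z ((chartAt V x).symm w))
  have h2 := rep_chart Z ((chartAt V x).map_target hw)
  rw [(chartAt V x).right_inv hw] at h h2
  rw [h2]
  exact h

theorem rep_hopfTorsion (X Y : Hopf V → V) (x : Hopf V) :
    rep (fun y ↦ hopfTorsion (chartAt V y y) (X y) (Y y)) x =ᶠ[nhds (chartAt V x x)]
      fun p ↦ hopfTorsion p (rep X x p) (rep Y x p) := by
  filter_upwards [(chartAt V x).open_target.mem_nhds (mem_chart_target V x)] with w hw
  rw [← (chartAt V x).right_inv hw]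
  have hy := (chartAt V x).map_target hw
  rw [rep_chart _ hy, rep_chart _ hy, rep_chart _ hy, ← hopfTorsion_smul_smul (ratio_ne_zero hy),
    ratio_smul_chart hy]

theorem rep_hopfCurvature (X Y Z : Hopf V → V) (x : Hopf V) :
    rep (fun y ↦ hopfCurvature (chartAt V y y) (X y) (Y y) (Z y)) x =ᶠ[nhds (chartAt V x x)]
      fun p ↦ hopfCurvature p (rep X x p) (rep Y x p) (rep Z x p) := by
  filter_upwards [(chartAt V x).open_target.mem_nhds (mem_chart_target V x)] with w hw
  rw [← (chartAt V x).right_inv hw]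
  have hy := (chartAt V x).map_target hw
  rw [rep_chart _ hy, rep_chart _ hy, rep_chart _ hy, rep_chart _ hy,
    ← hopfCurvature_smul_smul (ratio_ne_zero hy), ratio_smul_chart hy]

/-! ### Torsion and curvature from locally constant extensions -/

theorem differentiableFieldAt_extendField {x : Hopf V} (u : TangentSpace 𝓘(ℝ, V) x) :
    ∀ᶠ y in nhds x, DifferentiableFieldAt (AffineConnection.extendField u) y := by
  filter_upwards [(chartAt V x).open_source.mem_nhds (mem_chart_source V x)] with y hy
  exact (differentiableFieldAt_iff hy).2 <| (differentiableAt_const (F := V) u).congr_of_eventuallyEq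
    (eventually_rep_extendField (V := V) u hy)

theorem extendField_self {x : Hopf V} (u : TangentSpace 𝓘(ℝ, V) x) :
    AffineConnection.extendField u x = u := FiberBundle.extend_apply_self _ u

theorem fderiv_rep_extendField {x : Hopf V} (u : TangentSpace 𝓘(ℝ, V) x) :
    fderiv ℝ (rep (AffineConnection.extendField u) x) (chartAt V x x) = 0 :=
  (eventually_rep_extendField (V := V) u (mem_chart_source V x)).fderiv_eq.trans
    (hasFDerivAt_const (𝕜 := ℝ) (F := V) u (chartAt V x x)).fderiv

theorem hopfCov_congr {F G : V → V} {p : V} (h : F =ᶠ[nhds p] G) (v : V) :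
    hopfCov F p v = hopfCov G p v := by
  rw [hopfCov, hopfCov, h.fderiv_eq, h.eq_of_nhds]

theorem hopfCov_const (p u v : V) : hopfCov (fun _ ↦ v) p u = hopfChristoffel p u v := by
  simp [hopfCov]

theorem connection_extendField (x : Hopf V) (u v : TangentSpace 𝓘(ℝ, V) x) :
    connection V (AffineConnection.extendField v) x u = hopfChristoffel (chartAt V x x) u v :=
  (connection_apply _ x u).trans
    ((hopfCov_congr (V := V) (p := chartAt V x x) (G := fun _ ↦ v)
      (eventually_rep_extendField (V := V) v (mem_chart_source V x)) u).trans
      (hopfCov_const (V := V) _ _ _))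

theorem mlieBracket_extendField (x : Hopf V) (u v : TangentSpace 𝓘(ℝ, V) x) :
    VectorField.mlieBracket 𝓘(ℝ, V) (AffineConnection.extendField u)
      (AffineConnection.extendField v) x = 0 := by
  refine (mlieBracket_eq _ _ x).trans ?_
  rw [fderiv_rep_extendField, fderiv_rep_extendField]
  exact sub_zero (0 : V)

theorem torsion_connection (x : Hopf V) (u v : TangentSpace 𝓘(ℝ, V) x) :
    (connection V).torsion x u v = hopfTorsion (chartAt V x x) u v := by
  have h := (connection V).torsion_apply (differentiableFieldAt_extendField u).self_of_nhds
    (differentiableFieldAt_extendField v).self_of_nhds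
  rw [mlieBracket_extendField, extendField_self, extendField_self, sub_zero] at h
  rw [h]
  exact (congrArg₂ (fun a b : V ↦ a - b) (connection_extendField x u v)
    (connection_extendField x v u)).trans (hopfChristoffel_sub_swap _ _ _)

theorem rep_connection_extendField (x : Hopf V) (v w : TangentSpace 𝓘(ℝ, V) x) :
    rep (fun y ↦ connection V (AffineConnection.extendField w) y
      (AffineConnection.extendField v y)) x =ᶠ[nhds (chartAt V x x)]
        fun p : V ↦ hopfChristoffel (V := V) p v w := by
  refine (rep_connection (differentiableFieldAt_extendField w)).trans ?_
  filter_upwards [(eventually_rep_extendField (V := V) w (mem_chart_source V x)).eventuallyEq_nhds,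
    eventually_rep_extendField (V := V) v (mem_chart_source V x)] with p hp hp'
  exact (congrArg (hopfCov (rep (AffineConnection.extendField w) x) p) hp').trans
    ((hopfCov_congr (V := V) hp v).trans (hopfCov_const (V := V) p v w))

theorem connection_connection_extendField (x : Hopf V) (u v w : TangentSpace 𝓘(ℝ, V) x) :
    connection V (fun y ↦ connection V (AffineConnection.extendField w) y
        (AffineConnection.extendField v y)) x u =
      hopfCov (fun p : V ↦ hopfChristoffel (V := V) p v w) (chartAt V x x) u :=
  (connection_apply _ x u).trans
    (hopfCov_congr (V := V) (rep_connection_extendField x v w) u)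

theorem curvature_connection (x : Hopf V) (u v w : TangentSpace 𝓘(ℝ, V) x) :
    (connection V).curvature x u v w = hopfCurvature (chartAt V x x) u v w := by
  rw [AffineConnection.curvature, mlieBracket_extendField, map_zero, sub_zero]
  exact (congrArg₂ (fun a b : V ↦ a - b) (connection_connection_extendField x u v w)
    (connection_connection_extendField x v u w)).trans
      (hopfCov_hopfCov_sub (V := V) (chart_self_ne_zero x) u v w)

theorem hasParallelTorsion_connection : (connection V).HasParallelTorsion := by
  intro x X Y v hX hY
  have hX' := differentiableFieldAt_iff_self.1 hX
  have hY' := differentiableFieldAt_iff_self.1 hY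
  have e : (fun y ↦ (connection V).torsion y (X y) (Y y)) =
      fun y ↦ hopfTorsion (chartAt V y y) (X y) (Y y) :=
    funext fun y ↦ torsion_connection y (X y) (Y y)
  rw [e]
  refine (connection_apply _ x v).trans ((hopfCov_congr (V := V) (rep_hopfTorsion X Y x) v).trans
    ((hopfCov_hopfTorsion (chart_self_ne_zero x) hX' hY' v).trans ?_))
  rw [torsion_connection, torsion_connection, connection_apply, connection_apply]
  exact congrArg₂ (fun a b : V ↦ hopfTorsion (chartAt V x x) (hopfCov (rep X x) (chartAt V x x) v) b
    + hopfTorsion (chartAt V x x) a (hopfCov (rep Y x) (chartAt V x x) v))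
    (rep_self X x) (rep_self Y x)

theorem hasParallelCurvature_connection : (connection V).HasParallelCurvature := by
  intro x X Y Z v hX hY hZ
  have hX' := differentiableFieldAt_iff_self.1 hX
  have hY' := differentiableFieldAt_iff_self.1 hY
  have hZ' := differentiableFieldAt_iff_self.1 hZ
  have e : (fun y ↦ (connection V).curvature y (X y) (Y y) (Z y)) =
      fun y ↦ hopfCurvature (chartAt V y y) (X y) (Y y) (Z y) :=
    funext fun y ↦ curvature_connection y (X y) (Y y) (Z y)
  rw [e]
  refine (connection_apply _ x v).trans ((hopfCov_congr (V := V) (rep_hopfCurvature X Y Z x) v).trans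
    ((hopfCov_hopfCurvature (chart_self_ne_zero x) hX' hY' hZ' v).trans ?_))
  rw [curvature_connection, curvature_connection, curvature_connection, connection_apply,
    connection_apply, connection_apply]
  have h1 : rep X x (chartAt V x x) = X x := rep_self X x
  have h2 : rep Y x (chartAt V x x) = Y x := rep_self Y x
  have h3 : rep Z x (chartAt V x x) = Z x := rep_self Z x
  rw [h1, h2, h3]
  rfl

end Hopf

end HopfConnection

/-! ## The connection of the Hopf manifold is a Bismut connection -/

section HopfBismut

variable {V : Type*} [NormedAddCommGroup V] [InnerProductSpace ℂ V] [FiniteDimensional ℂ V]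

theorem ContDiffAt.hopfForm {n : ℕ∞ω} {F G : V → V} {p : V} (hp : p ≠ 0)
    (hF : ContDiffAt ℝ n F p) (hG : ContDiffAt ℝ n G p) :
    ContDiffAt ℝ n (fun x ↦ hopfForm x (F x) (G x)) p :=
  ContDiffAt.mul (ContDiffAt.inv (contDiffAt_id.inner ℂ contDiffAt_id)
    (inner_self_ne_zero.2 hp)) (hF.inner ℂ hG)

theorem ContDiffAt.hopfChristoffel {n : ℕ∞ω} {F G : V → V} {p : V} (hp : p ≠ 0)
    (hF : ContDiffAt ℝ n F p) (hG : ContDiffAt ℝ n G p) :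
    ContDiffAt ℝ n (fun x ↦ hopfChristoffel x (F x) (G x)) p := by
  have hid : ContDiffAt ℝ n (fun x : V ↦ x) p := contDiffAt_id
  exact (((ContDiffAt.hopfForm hp hF hG).smul hid).sub
    ((ContDiffAt.hopfForm hp hid hG).smul hF)).sub ((ContDiffAt.hopfForm hp hF hid).smul hG)

/-- In finite dimension a linear map is its tuple of values on a basis, so smoothness may be tested
vector by vector. -/
theorem ContDiffAt.of_clm_apply {E F G : Type*} [NormedAddCommGroup E] [NormedSpace ℝ E]
    [FiniteDimensional ℝ E] [NormedAddCommGroup F] [NormedSpace ℝ F] [NormedAddCommGroup G]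
    [NormedSpace ℝ G] {n : ℕ∞ω} {f : G → E →L[ℝ] F} {p : G}
    (h : ∀ v, ContDiffAt ℝ n (fun x ↦ f x v) p) : ContDiffAt ℝ n f p := by
  let e₁ : E ≃L[ℝ] (Fin (Module.finrank ℝ E) → ℝ) :=
    ContinuousLinearEquiv.ofFinrankEq (Module.finrank_fin_fun ℝ).symm
  let e₂ := (e₁.arrowCongr (1 : F ≃L[ℝ] F)).trans
    (ContinuousLinearEquiv.piRing (Fin (Module.finrank ℝ E)))
  rw [← Function.id_comp f, ← e₂.symm_comp_self]
  exact e₂.symm.contDiff.contDiffAt.comp p (contDiffAt_pi.2 fun i ↦ h _)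

namespace Hopf

theorem contMDiffAt_connection {Y : (x : Hopf V) → TangentSpace 𝓘(ℝ, V) x} {x : Hopf V}
    (hY : ContMDiff 𝓘(ℝ, V) 𝓘(ℝ, V).tangent ∞
      (fun y ↦ (⟨y, Y y⟩ : TangentBundle 𝓘(ℝ, V) (Hopf V)))) :
    ContMDiffAt 𝓘(ℝ, V) (𝓘(ℝ, V).prod 𝓘(ℝ, V →L[ℝ] V)) ∞
      (fun x : Hopf V ↦ Bundle.TotalSpace.mk' (V →L[ℝ] V)
        (E := fun x : Hopf V ↦ TangentSpace 𝓘(ℝ, V) x →L[ℝ] TangentSpace 𝓘(ℝ, V) x)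
        x (connection V Y x)) x := by
  rw [Bundle.contMDiffAt_section]
  have h1 : ContDiffAt ℝ ∞ (fun p ↦ fderiv ℝ (rep Y x) p + hopfChristoffelL p (rep Y x p))
      (chartAt V x x) := by
    have h := contDiffAt_rep (hY x)
    refine (h.fderiv_right (by simp)).add (.of_clm_apply fun v ↦ ?_)
    exact ContDiffAt.hopfChristoffel (chart_self_ne_zero x) contDiffAt_const h
  refine ((contMDiffAt_comp_chart_iff (mem_chart_source V x)).2 h1).congr_of_eventuallyEq ?_
  filter_upwards [(chartAt V x).open_source.mem_nhds (mem_chart_source V x)] with y hy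
  refine ContinuousLinearMap.ext fun v ↦ ?_
  have hs := congrArg (fun L : V →L[ℝ] V ↦ L v)
    (TangentBundle.symmL_trivializationAt_eq_core (I := 𝓘(ℝ, V)) hy)
  -- In coordinates at x the endomorphism sends v to the fibre over y as w = 2^k v, applies the
  -- connection there, and returns by the norm ratio 2^(−k). By `hr` this is the formula of
  -- `ratio_smul_connection` in direction v.
  set w : V := (trivializationAt V (TangentSpace 𝓘(ℝ, V)) x).symmL ℝ y v with hw
  obtain ⟨k, hk, hk'⟩ := Hopf.tangentCoordChange_eq hy
  have hkw : w = (2 : ℂ) ^ k • v := hs.trans (hk' v)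
  have hr : ((‖chartAt V x y‖ / ‖chartAt V y y‖ : ℝ) : ℂ) • w = v := by
    have h3 : ‖chartAt V x y‖ ≠ 0 := norm_ne_zero_iff.2 (chart_ne_zero hy)
    have h4 : (2 : ℝ) ^ k ≠ 0 := by positivity
    rw [hkw, hk, norm_smul, norm_two_zpow, smul_smul,
      show ‖chartAt V x y‖ / (2 ^ k * ‖chartAt V x y‖) = ((2 : ℝ) ^ k)⁻¹ by field_simp,
      show (2 : ℂ) ^ k = ((2 ^ k : ℝ) : ℂ) by push_cast; rfl, ← Complex.ofReal_mul,
      inv_mul_cancel₀ h4, Complex.ofReal_one, one_smul]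
  have h2 := ratio_smul_connection hy ((hY y).mdifferentiableAt (by simp)) w
  rw [hr] at h2
  refine Eq.trans ?_ h2
  refine Eq.trans ?_ (trivializationAt_snd hy (connection V Y y w))
  exact Bundle.Trivialization.continuousLinearMapAt_apply_of_mem (R := ℝ)
    (trivializationAt V (TangentSpace 𝓘(ℝ, V)) x)
    (show y ∈ (trivializationAt V (TangentSpace 𝓘(ℝ, V)) x).baseSet from hy) _

theorem contMDiffCovariantDerivative_connection :
    (connection V).ContMDiffCovariantDerivative ∞ where
  contMDiff :=
    { contMDiff := fun {Y} hY x _ ↦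
        (contMDiffAt_connection (contMDiffOn_univ.1 hY)).contMDiffWithinAt }

theorem hopfMetric_inner (x : Hopf V) (u v : V) :
    (hopfMetric V).inner x u v = 2 * (hopfForm (chartAt V x x) u v).re := by
  refine (hopfInner_apply x u v).trans ?_
  rw [hopfForm, inner_self_eq_norm_sq_to_K, show (RCLike.ofReal ‖chartAt V x x‖ : ℂ) = Complex.ofReal ‖chartAt V x x‖ from rfl,
    ← Complex.ofReal_pow,
    ← Complex.ofReal_inv, Complex.re_ofReal_mul]
  ring

theorem hopfForm_rep (Y Z : Hopf V → V) {x y : Hopf V} (hy : y ∈ (chartAt V x).source) :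
    hopfForm (chartAt V x y) (rep Y x (chartAt V x y)) (rep Z x (chartAt V x y)) =
      hopfForm (chartAt V y y) (Y y) (Z y) := by
  rw [rep_chart _ hy, rep_chart _ hy, ← hopfForm_smul_smul (ratio_ne_zero hy) (chartAt V y y),
    ratio_smul_chart hy]

theorem fderiv_hopfForm_rep (Y Z : Hopf V → V) {x : Hopf V}
    (hY : DifferentiableAt ℝ (rep Y x) (chartAt V x x))
    (hZ : DifferentiableAt ℝ (rep Z x) (chartAt V x x)) (v : V) :
    fderiv ℝ (fun p ↦ hopfForm p (rep Y x p) (rep Z x p)) (chartAt V x x) v =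
      hopfForm (chartAt V x x) (hopfCov (rep Y x) (chartAt V x x) v) (Z x)
        + hopfForm (chartAt V x x) (Y x) (hopfCov (rep Z x) (chartAt V x x) v) := by
  rw [fderiv_hopfForm_eq_hopfCov (chart_self_ne_zero x) hY hZ, rep_self, rep_self]

theorem connection_metric {x : Hopf V} {Y Z : (x : Hopf V) → TangentSpace 𝓘(ℝ, V) x}
    (hY : DifferentiableFieldAt Y x) (hZ : DifferentiableFieldAt Z x)
    (v : TangentSpace 𝓘(ℝ, V) x) :
    mfderiv 𝓘(ℝ, V) 𝓘(ℝ, ℝ) (fun y ↦ (hopfMetric V).inner y (Y y) (Z y)) x v =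
      (hopfMetric V).inner x (connection V Y x v) (Z x) +
        (hopfMetric V).inner x (Y x) (connection V Z x v) := by
  have hY' := differentiableFieldAt_iff_self.1 hY
  have hZ' := differentiableFieldAt_iff_self.1 hZ
  set f : V → ℝ := fun p ↦ 2 * (hopfForm p (rep Y x p) (rep Z x p)).re with hf
  have hH := DifferentiableAt.hopfForm (chart_self_ne_zero x) hY' hZ'
  have hd : HasFDerivAt f ((2 : ℝ) • Complex.reCLM.comp
      (fderiv ℝ (fun p ↦ hopfForm p (rep Y x p) (rep Z x p)) (chartAt V x x))) (chartAt V x x) :=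
    (Complex.reCLM.hasFDerivAt.comp _ hH.hasFDerivAt).const_mul 2
  have he : (fun y ↦ (hopfMetric V).inner y (Y y) (Z y)) =ᶠ[nhds x] f ∘ chartAt V x := by
    filter_upwards [(chartAt V x).open_source.mem_nhds (mem_chart_source V x)] with y hy
    exact (hopfMetric_inner y (Y y) (Z y)).trans
      (congrArg (fun c : ℂ ↦ 2 * c.re) (hopfForm_rep Y Z hy).symm)
  rw [he.mfderiv_eq]
  refine (mfderiv_comp_chart hd.differentiableAt v).trans ?_
  rw [hd.fderiv]
  refine Eq.trans ?_ (congrArg₂ (· + ·) (hopfMetric_inner x (connection V Y x v) (Z x))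
    (hopfMetric_inner x (Y x) (connection V Z x v))).symm
  rw [connection_apply, connection_apply]
  refine (congrArg (fun c : ℂ ↦ 2 * c.re) (fderiv_hopfForm_rep Y Z hY' hZ' v)).trans ?_
  exact (congrArg (2 * ·) (Complex.add_re _ _)).trans (mul_add _ _ _)

theorem rep_complexStructure (Y : (x : Hopf V) → TangentSpace 𝓘(ℝ, V) x) (x : Hopf V) :
    rep (fun y ↦ complexStructure y (Y y)) x = fun p ↦ Complex.I • rep Y x p := by
  ext p
  exact smul_comm _ Complex.I (show V from Y _)

/-- Γ_p(u,·) is complex linear, so the constant factor i passes through `hopfCov`. -/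
theorem connection_complex {x : Hopf V} {Y : (x : Hopf V) → TangentSpace 𝓘(ℝ, V) x}
    (hY : DifferentiableFieldAt Y x) (v : TangentSpace 𝓘(ℝ, V) x) :
    connection V (fun y ↦ complexStructure y (Y y)) x v =
      complexStructure x (connection V Y x v) := by
  refine (connection_apply _ x v).trans (Eq.trans ?_
    (congrArg (fun w : V ↦ Complex.I • w) (connection_apply Y x v).symm))
  rw [rep_complexStructure]
  refine (hopfCov_smul (V := V) (differentiableAt_const Complex.I)
    (differentiableFieldAt_iff_self.1 hY) v).trans ?_
  rw [(hasFDerivAt_const (𝕜 := ℝ) Complex.I (chartAt V x x)).fderiv]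
  exact (congrArg₂ (· + ·) rfl (zero_smul ℂ _)).trans (add_zero _)

theorem isBismut_connection : (hopfMetric V).IsBismut (connection V) where
  smooth := contMDiffCovariantDerivative_connection
  metric := connection_metric
  complex := connection_complex
  skew x u v w := by
    rw [torsion_connection, torsion_connection]
    refine (hopfMetric_inner x _ w).trans (Eq.trans ?_
      (congrArg (fun r : ℝ ↦ -r) (hopfMetric_inner x _ v)).symm)
    rw [← mul_neg]
    exact congrArg (2 * ·) (hopfForm_hopfTorsion_skew (V := V) _ _ _ _)

end Hopf
end HopfBismut

/-! ## Uniqueness of the Bismut connection -/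

/-- A totally skew-symmetric `3`-form for which `J` is skew in the last two arguments vanishes. -/
theorem eq_zero_of_skew_of_complex {T : Type*} {J : T → T} (hJ : Function.Surjective J)
    {B : T → T → T → ℝ} (h1 : ∀ u v w, B u v w = -B u w v)
    (h2 : ∀ u v w, B u v w - B v u w = -(B u w v - B w u v))
    (h3 : ∀ u v w, B u (J v) w = -B u v (J w)) (u v w : T) : B u v w = 0 := by
  -- Given `h1`, the left and right first terms of `h2` cancel and skewness in the outer slots is
  -- left.
  have h13 : ∀ u v w, B u v w = -B w v u := by
    intro u v w
    linarith [h2 v u w, h1 v u w]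
  have h12 : ∀ u v w, B u v w = -B v u w := by
    intro u v w
    linarith [h1 u v w, h13 u w v, h1 v w u]
  -- By total skewness J moves between any two slots at the cost of a sign. Taking it once around
  -- the three slots gives (−1)³, so a value with one J equals its own negative; surjectivity
  -- supplies the J.
  obtain ⟨v, rfl⟩ := hJ v
  linarith [h12 (J u) v w, h3 v u w, h12 v u (J w), h3 u v w, h13 (J u) v w, h3 w v u,
    h13 w (J v) u]

section HopfUnique

variable {V : Type*} [NormedAddCommGroup V] [InnerProductSpace ℂ V] [FiniteDimensional ℂ V]

namespace Hopf

variable {D : AffineConnection V (Hopf V)}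

theorem differentiableFieldAt_complexStructure {Y : (x : Hopf V) → TangentSpace 𝓘(ℝ, V) x}
    {x : Hopf V} (hY : DifferentiableFieldAt Y x) :
    DifferentiableFieldAt (fun y ↦ complexStructure y (Y y)) x := by
  refine differentiableFieldAt_iff_self.2 ?_
  rw [rep_complexStructure]
  exact (differentiableAt_const Complex.I).smul (differentiableFieldAt_iff_self.1 hY)

theorem complexStructure_complexStructure {x : Hopf V} (u : TangentSpace 𝓘(ℝ, V) x) :
    complexStructure x (complexStructure x u) = -u := by
  change Complex.I • Complex.I • (show V from u) = -(show V from u)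
  rw [smul_smul, Complex.I_mul_I, neg_one_smul]

theorem inner_complexStructure_left {x : Hopf V} (u v : TangentSpace 𝓘(ℝ, V) x) :
    (hopfMetric V).inner x (complexStructure x u) v =
      -(hopfMetric V).inner x u (complexStructure x v) := by
  rw [← (hopfMetric V).hermitian, complexStructure_complexStructure, map_neg,
    neg_apply]

/-- The Bismut connection of the Hopf manifold is unique. -/
theorem eq_connection_of_isBismut (hD : (hopfMetric V).IsBismut D)
    {Y : (x : Hopf V) → TangentSpace 𝓘(ℝ, V) x} {x : Hopf V} (hY : DifferentiableFieldAt Y x) :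
    D Y x = connection V Y x := by
  have hC := isBismut_connection (V := V)
  set A := D.isCovariantDerivativeOnUniv.difference
    (connection V).isCovariantDerivativeOnUniv x with hA
  have hAY {Y : (x : Hopf V) → TangentSpace 𝓘(ℝ, V) x} (hY : DifferentiableFieldAt Y x) :
      A (Y x) = D Y x - connection V Y x :=
    IsCovariantDerivativeOn.difference_apply _ _ (Set.mem_univ x) hY
  have hext (u : TangentSpace 𝓘(ℝ, V) x) :=
    (differentiableFieldAt_extendField u).self_of_nhds
  have hAe (u v : TangentSpace 𝓘(ℝ, V) x) :
      A u v = D (AffineConnection.extendField u) x v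
        - connection V (AffineConnection.extendField u) x v := by
    have h := hAY (hext u)
    rw [extendField_self] at h
    rw [h]; rfl
  -- B(u,v,w) = g((D_u − ∇_u)v, w). Its three hypotheses are the difference of the two metric
  -- conditions, of the two torsion conditions and of the two conditions on J.
  have key := eq_zero_of_skew_of_complex (J := complexStructure x)
    (B := fun u v w ↦ (hopfMetric V).inner x (A v u) w) ?_ ?_ ?_ ?_
  · have h0 : ∀ u v, A v u = 0 := by
      intro u v
      by_contra hne
      exact ((hopfMetric V).pos x _ hne).ne' (key u v (A v u))
    refine ContinuousLinearMap.ext fun v ↦ ?_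
    have h := h0 v (Y x)
    rw [hAY hY] at h
    exact sub_eq_zero.1 h
  · intro u
    exact ⟨complexStructure x (-u), by rw [map_neg, map_neg, complexStructure_complexStructure,
      neg_neg]⟩
  · intro u v w
    have h : (hopfMetric V).inner x (D (AffineConnection.extendField v) x u) w
          + (hopfMetric V).inner x v (D (AffineConnection.extendField w) x u) =
        (hopfMetric V).inner x (connection V (AffineConnection.extendField v) x u) w
          + (hopfMetric V).inner x v (connection V (AffineConnection.extendField w) x u) := by
      have h' := (hD.metric (hext v) (hext w) u).symm.trans (hC.metric (hext v) (hext w) u)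
      simp only [extendField_self] at h'
      exact h'
    have hs := (hopfMetric V).symm x v (A w u)
    simp only [hAe, map_sub, sub_apply] at hs ⊢
    linarith
  · intro u v w
    have ht (u v : TangentSpace 𝓘(ℝ, V) x) : D.torsion x u v - (connection V).torsion x u v =
        A v u - A u v := by
      have e1 := D.torsion_apply (hext u) (hext v)
      have e2 := (connection V).torsion_apply (hext u) (hext v)
      simp only [extendField_self] at e1 e2
      rw [e1, e2, hAe, hAe]
      abel
    have hB (u v w : TangentSpace 𝓘(ℝ, V) x) :
        (hopfMetric V).inner x (D.torsion x u v) w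
          - (hopfMetric V).inner x ((connection V).torsion x u v) w
        = (hopfMetric V).inner x (A v u) w - (hopfMetric V).inner x (A u v) w := by
      rw [← sub_apply, ← map_sub, ht, map_sub, sub_apply]
    have h := hD.skew x u v w
    have h' := hC.skew x u v w
    have b1 := hB u v w
    have b2 := hB u w v
    linarith
  · intro u v w
    have h1 : A (complexStructure x v) u = complexStructure x (A v u) := by
      have h := hAY (differentiableFieldAt_complexStructure (hext v))
      simp only [extendField_self] at h
      rw [h, hAe, map_sub, ← hD.complex (hext v), ← hC.complex (hext v)]
      rfl
    rw [h1, inner_complexStructure_left]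

/-! ### Transfer to an arbitrary Bismut connection -/

theorem torsion_of_isBismut (hD : (hopfMetric V).IsBismut D) (x : Hopf V)
    (u v : TangentSpace 𝓘(ℝ, V) x) : D.torsion x u v = (connection V).torsion x u v := by
  rw [D.torsion_apply_eq_extend, (connection V).torsion_apply_eq_extend]
  erw [eq_connection_of_isBismut hD (differentiableFieldAt_extendField u).self_of_nhds,
    eq_connection_of_isBismut hD (differentiableFieldAt_extendField v).self_of_nhds]
  rfl

theorem differentiableFieldAt_connection_extendField (x : Hopf V)
    (v w : TangentSpace 𝓘(ℝ, V) x) :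
    DifferentiableFieldAt (fun y ↦ connection V (AffineConnection.extendField w) y
      (AffineConnection.extendField v y)) x := by
  refine differentiableFieldAt_iff_self.2
    (DifferentiableAt.congr_of_eventuallyEq ?_ (rep_connection_extendField x v w))
  exact (ContDiffAt.hopfChristoffel (n := 1) (chart_self_ne_zero x) contDiffAt_const
    contDiffAt_const).differentiableAt (by simp)

/-- Uniqueness holds at every point near x, so the two inner derivatives have the same germ;
locality of D replaces the inner one, then uniqueness at x replaces the outer one. -/
theorem connection_connection_of_isBismut (hD : (hopfMetric V).IsBismut D) (x : Hopf V)
    (v w : TangentSpace 𝓘(ℝ, V) x) :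
    D (fun y ↦ D (AffineConnection.extendField w) y (AffineConnection.extendField v y)) x =
      connection V (fun y ↦ connection V (AffineConnection.extendField w) y
        (AffineConnection.extendField v y)) x := by
  have he : ∀ᶠ y in nhds x,
      D (AffineConnection.extendField w) y (AffineConnection.extendField v y) =
        connection V (AffineConnection.extendField w) y (AffineConnection.extendField v y) := by
    filter_upwards [differentiableFieldAt_extendField w] with y hy
    rw [eq_connection_of_isBismut hD hy]
  have h2 := differentiableFieldAt_connection_extendField x v w
  have h1 : DifferentiableFieldAt (fun y ↦ D (AffineConnection.extendField w) y
      (AffineConnection.extendField v y)) x := by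
    refine MDifferentiableAt.congr_of_eventuallyEq h2 ?_
    filter_upwards [he] with y hy
    rw [hy]
  rw [D.isCovariantDerivativeOnUniv.congr_of_eventuallyEq h1 h2 Filter.univ_mem he,
    eq_connection_of_isBismut hD h2]

theorem curvature_of_isBismut (hD : (hopfMetric V).IsBismut D) (x : Hopf V)
    (u v w : TangentSpace 𝓘(ℝ, V) x) : D.curvature x u v w = (connection V).curvature x u v w := by
  rw [AffineConnection.curvature, AffineConnection.curvature,
    connection_connection_of_isBismut hD, connection_connection_of_isBismut hD,
    eq_connection_of_isBismut hD (differentiableFieldAt_extendField w).self_of_nhds]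

/-- Uniqueness compares connections on differentiable fields only, so the field T(X,Y) must be shown
differentiable before D can be exchanged for the explicit connection. -/
theorem differentiableFieldAt_torsion {X Y : (x : Hopf V) → TangentSpace 𝓘(ℝ, V) x} {x : Hopf V}
    (hX : DifferentiableFieldAt X x) (hY : DifferentiableFieldAt Y x) :
    DifferentiableFieldAt (fun y ↦ (connection V).torsion y (X y) (Y y)) x := by
  simp only [torsion_connection]
  exact differentiableFieldAt_iff_self.2 (DifferentiableAt.congr_of_eventuallyEq
    ((differentiableFieldAt_iff_self.1 hX).hopfTorsion (chart_self_ne_zero x)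
      (differentiableFieldAt_iff_self.1 hY)) (rep_hopfTorsion X Y x))

theorem differentiableFieldAt_curvature {X Y Z : (x : Hopf V) → TangentSpace 𝓘(ℝ, V) x}
    {x : Hopf V} (hX : DifferentiableFieldAt X x) (hY : DifferentiableFieldAt Y x)
    (hZ : DifferentiableFieldAt Z x) :
    DifferentiableFieldAt (fun y ↦ (connection V).curvature y (X y) (Y y) (Z y)) x := by
  simp only [curvature_connection]
  exact differentiableFieldAt_iff_self.2 (DifferentiableAt.congr_of_eventuallyEq
    ((differentiableFieldAt_iff_self.1 hX).hopfCurvature (chart_self_ne_zero x)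
      (differentiableFieldAt_iff_self.1 hY) (differentiableFieldAt_iff_self.1 hZ))
    (rep_hopfCurvature X Y Z x))

variable (V) in
theorem isBismutAmbroseSinger : (hopfMetric V).IsBismutAmbroseSinger := by
  refine ⟨⟨connection V, isBismut_connection⟩, fun D hD ↦ ⟨?_, ?_⟩⟩
  · intro x X Y v hX hY
    have h := hasParallelTorsion_connection x X Y v hX hY
    simp only [torsion_of_isBismut hD]
    rw [eq_connection_of_isBismut hD (differentiableFieldAt_torsion hX hY),
      eq_connection_of_isBismut hD hX, eq_connection_of_isBismut hD hY, h]
  · intro x X Y Z v hX hY hZ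
    have h := hasParallelCurvature_connection x X Y Z v hX hY hZ
    simp only [curvature_of_isBismut hD]
    rw [eq_connection_of_isBismut hD (differentiableFieldAt_curvature hX hY hZ),
      eq_connection_of_isBismut hD hX, eq_connection_of_isBismut hD hY,
      eq_connection_of_isBismut hD hZ, h]

end Hopf
end HopfUnique

/-! ## The first Ricci curvature -/

section HopfRicci

variable {V : Type*} [NormedAddCommGroup V] [InnerProductSpace ℂ V]

theorem hopfProj_smul_right (p w : V) (c : ℂ) : hopfProj p (c • w) = c • hopfProj p w := by
  simp only [hopfProj, hopfForm_smul_right]; module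

theorem hopfCurvature_smul_right (p u v w : V) (c : ℂ) :
    hopfCurvature p u v (c • w) = c • hopfCurvature p u v w := by
  simp only [hopfCurvature, hopfProj_smul_right, hopfForm_smul_right]; module

/-- As u ⊥ p, the projection fixes u and iu, and h(u,iu) − h(iu,u) = 2i h(u,u); the other two terms
each give −i h(u,w)u. -/
theorem hopfCurvature_I_smul {p u : V} (hu : inner ℂ p u = 0) (w : V) :
    hopfCurvature p u (Complex.I • u) w =
      (2 * Complex.I * hopfForm p u u) • (w - hopfForm p p w • p)
        - (2 * Complex.I * hopfForm p u w) • u := by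
  have h1 : hopfForm p p u = 0 := by simp [hopfForm, hu]
  have h2 : hopfForm p u p = 0 := by rw [← hopfForm_conj, h1, map_zero]
  simp only [hopfCurvature, hopfProj, hopfForm_sub_right, hopfForm_smul_right, hopfForm_smul_left,
    hopfForm_sub_left, h1, h2, Complex.conj_I, map_zero, mul_zero]
  module

/-- The projection off p has trace n − 1, and the rank-one term removes one more h(u,u), hence n −
2. The sign is that of a conjugate, the image standing in the conjugate-linear slot. -/
theorem sum_inner_hopfCurvature_I_smul {ι : Type*} [Fintype ι] (b : OrthonormalBasis ι ℂ V)
    {p u : V} (hp : p ≠ 0) (hu : inner ℂ p u = 0) :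
    ∑ i, inner ℂ (hopfCurvature p u (Complex.I • u) (b i)) (b i) =
      -2 * Complex.I * (Fintype.card ι - 2) * hopfForm p u u := by
  have h0 : (inner ℂ p p : ℂ) ≠ 0 := inner_self_ne_zero.2 hp
  have hb (i : ι) : inner ℂ (hopfCurvature p u (Complex.I • u) (b i)) (b i) =
      -2 * Complex.I * hopfForm p u u
        + 2 * Complex.I * hopfForm p u u * (inner ℂ p p)⁻¹ * (inner ℂ p (b i) * inner ℂ (b i) p)
        + 2 * Complex.I * (inner ℂ p p)⁻¹ * (inner ℂ u (b i) * inner ℂ (b i) u) := by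
    rw [hopfCurvature_I_smul hu, inner_sub_left, inner_smul_left, inner_smul_left,
      inner_sub_left, inner_smul_left]
    simp only [map_mul, hopfForm_conj, Complex.conj_I, map_ofNat]
    rw [inner_self_eq_norm_sq_to_K (b i), b.norm_eq_one]
    simp only [hopfForm]
    push_cast
    ring
  rw [Finset.sum_congr rfl fun i _ ↦ hb i, Finset.sum_add_distrib, Finset.sum_add_distrib]
  simp only [← Finset.mul_sum, b.sum_inner_mul_inner, Finset.sum_const, Finset.card_univ,
    nsmul_eq_mul, hopfForm]
  field_simp
  ring

theorem exists_ne_zero_inner_eq_zero [FiniteDimensional ℂ V] (h : 2 ≤ Module.finrank ℂ V) (p : V) :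
    ∃ u : V, u ≠ 0 ∧ inner ℂ p u = 0 := by
  have hne : (Submodule.span ℂ {p})ᗮ ≠ ⊥ := by
    intro hbot
    rw [Submodule.orthogonal_eq_bot_iff] at hbot
    have h1 := finrank_span_le_card (R := ℂ) ({p} : Set V)
    rw [hbot, finrank_top] at h1
    simp at h1
    omega
  obtain ⟨u, hu, hu0⟩ := Submodule.exists_mem_ne_zero_of_ne_bot hne
  exact ⟨u, hu0, Submodule.mem_orthogonal_singleton_iff_inner_right.1 hu⟩

/-! ### The Ricci form in a rescaled orthonormal frame -/

namespace Hopf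

variable [FiniteDimensional ℂ V]

theorem hopfForm_norm_div_sqrt_two_smul {p : V} (hp : p ≠ 0) (u v : V) :
    hopfForm p (((‖p‖ / √2 : ℝ) : ℂ) • u) (((‖p‖ / √2 : ℝ) : ℂ) • v) = 2⁻¹ * inner ℂ u v := by
  have h : (‖p‖ : ℂ) ≠ 0 := by simpa using hp
  have h2 : ((√2 : ℝ) : ℂ) * ((√2 : ℝ) : ℂ) = 2 := by
    rw [← Complex.ofReal_mul, Real.mul_self_sqrt (by norm_num)]; simp
  have h3 : ((√2 : ℝ) : ℂ) ≠ 0 := by simp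
  rw [hopfForm_smul_left, hopfForm_smul_right, hopfForm, inner_self_eq_norm_sq_to_K,
    Complex.conj_ofReal]
  change _ * (_ * (((‖p‖ : ℂ) ^ 2)⁻¹ * _)) = _
  push_cast
  field_simp
  rw [pow_two, h2]
  ring

/-- A unitary frame at `x` obtained by rescaling an orthonormal basis. -/
def frame (x : Hopf V) (i : Fin (Module.finrank ℂ V)) : V :=
  ((‖chartAt V x x‖ / √2 : ℝ) : ℂ) • stdOrthonormalBasis ℂ V i

theorem isUnitaryFrame_frame (x : Hopf V) : (hopfMetric V).IsUnitaryFrame x (frame x) := by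
  intro i j
  have h1 := hopfForm_norm_div_sqrt_two_smul (chart_self_ne_zero x) (stdOrthonormalBasis ℂ V i)
    (stdOrthonormalBasis ℂ V j)
  rw [OrthonormalBasis.inner_eq_ite] at h1
  constructor
  · refine (hopfMetric_inner x _ _).trans ?_
    rw [frame, frame, h1]
    split_ifs <;> simp
  · refine (hopfMetric_inner x (frame x i) (Complex.I • frame x j)).trans ?_
    rw [hopfForm_smul_right, frame, frame, h1]
    split_ifs <;> simp

/-- R(u,v) is complex linear in its last slot, so both cross terms of R(u,v,e,ē) equal −Im
h(R(u,v)w,w); the two factors 1/√2 absorb the 2 in the metric 2 Re h. -/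
theorem re_hopfForm_hopfCurvature_add (p u v w : V) :
    2 * (hopfForm p (hopfCurvature p u v ((√2)⁻¹ • w)) ((√2)⁻¹ • Complex.I • w)).re
      + 2 * (hopfForm p (hopfCurvature p u v (-((√2)⁻¹ • Complex.I • w))) ((√2)⁻¹ • w)).re =
    -2 * (hopfForm p (hopfCurvature p u v w) w).im := by
  have e : -((√2)⁻¹ • Complex.I • w) = (((√2)⁻¹ : ℝ) * -Complex.I : ℂ) • w := by
    rw [← Complex.coe_smul]; module
  have h2 : ((√2)⁻¹ : ℝ) * (√2)⁻¹ = 2⁻¹ := by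
    rw [← mul_inv, Real.mul_self_sqrt (by norm_num)]
  rw [e, ← Complex.coe_smul, ← Complex.coe_smul]
  simp only [hopfCurvature_smul_right, hopfForm_smul_left, hopfForm_smul_right, map_mul, map_neg,
    Complex.conj_ofReal, Complex.conj_I, neg_neg]
  have h3 : ((((√2)⁻¹ : ℝ) : ℂ)) * (((√2)⁻¹ : ℝ) : ℂ) = ((2⁻¹ : ℝ) : ℂ) := by
    rw [← Complex.ofReal_mul, h2]
  generalize hopfForm p (hopfCurvature p u v w) w = z
  generalize ((((√2)⁻¹ : ℝ) : ℂ)) = s at h3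
  rw [show s * (Complex.I * (s * z)) = (s * s) * (Complex.I * z) by ring,
    show s * (s * Complex.I * z) = (s * s) * (Complex.I * z) by ring, h3, Complex.re_ofReal_mul]
  simp
  ring

/-- The imaginary part alone suffices to show that the Ricci form is nonzero. -/
theorem complexCurvature_im (x : Hopf V) (u v w : TangentSpace 𝓘(ℝ, V) x) :
    ((hopfMetric V).complexCurvature (connection V) x u v
      ((√2)⁻¹ • w, -((√2)⁻¹ • complexStructure x w))
      ((√2)⁻¹ • w, (√2)⁻¹ • complexStructure x w)).im =
      -2 * (hopfForm (chartAt V x x) (hopfCurvature (chartAt V x x) u v w) w).im := by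
  simp only [HermitianMetric.complexCurvature, curvature_connection]
  refine Eq.trans ?_ (re_hopfForm_hopfCurvature_add (V := V) (chartAt V x x) u v w)
  exact congrArg₂ (· + ·) (hopfMetric_inner x _ _) (hopfMetric_inner x _ _)

theorem firstRicci_im (x : Hopf V) (ε : Fin (Module.finrank ℂ V) → TangentSpace 𝓘(ℝ, V) x)
    (u v : TangentSpace 𝓘(ℝ, V) x) :
    ((hopfMetric V).firstRicci (connection V) x ε u v).im =
      ∑ i, -2 * (hopfForm (chartAt V x x) (hopfCurvature (chartAt V x x) u v (ε i)) (ε i)).im := by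
  rw [HermitianMetric.firstRicci, Complex.im_sum]
  exact Finset.sum_congr rfl fun i _ ↦ complexCurvature_im x u v (ε i)

theorem firstRicci_of_isBismut {D : AffineConnection V (Hopf V)} (hD : (hopfMetric V).IsBismut D)
    (x : Hopf V) (ε : Fin (Module.finrank ℂ V) → TangentSpace 𝓘(ℝ, V) x)
    (u v : TangentSpace 𝓘(ℝ, V) x) :
    (hopfMetric V).firstRicci D x ε u v = (hopfMetric V).firstRicci (connection V) x ε u v := by
  simp only [HermitianMetric.firstRicci, HermitianMetric.complexCurvature,
    curvature_of_isBismut hD]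

theorem firstRicci_frame_im (x : Hopf V) {u : V} (hu : inner ℂ (chartAt V x x) u = 0) :
    ((hopfMetric V).firstRicci (connection V) x (frame x) u (Complex.I • u : V)).im =
      2 * (Module.finrank ℂ V - 2) * (hopfForm (chartAt V x x) u u).re := by
  have e (i : Fin (Module.finrank ℂ V)) :
      -2 * (hopfForm (chartAt V x x) (hopfCurvature (chartAt V x x) u (Complex.I • u) (frame x i))
        (frame x i)).im = -(inner ℂ (hopfCurvature (chartAt V x x) u (Complex.I • u)
          (stdOrthonormalBasis ℂ V i)) (stdOrthonormalBasis ℂ V i)).im := by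
    rw [frame, hopfCurvature_smul_right, hopfForm_norm_div_sqrt_two_smul (chart_self_ne_zero x)]
    simp
  refine (firstRicci_im x (frame x) u (Complex.I • u : V)).trans
    ((Finset.sum_congr rfl fun i _ ↦ e i).trans ?_)
  rw [Finset.sum_neg_distrib, ← Complex.im_sum,
    sum_inner_hopfCurvature_I_smul _ (chart_self_ne_zero x) hu]
  have h : (hopfForm (chartAt V x x) u u).im = 0 :=
    Complex.conj_eq_iff_im.1 (hopfForm_conj _ _ _)
  simp [h]

theorem not_firstRicciVanishes (h : 3 ≤ Module.finrank ℂ V) {D : AffineConnection V (Hopf V)}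
    (hD : (hopfMetric V).IsBismut D) : ¬ (hopfMetric V).FirstRicciVanishes D := by
  intro hR
  have : Nontrivial V := Module.nontrivial_of_finrank_pos (R := ℂ) (by omega)
  obtain ⟨z, hz⟩ := exists_ne (0 : V)
  set x : Hopf V := proj ⟨z, hz⟩
  -- The Ricci form is tested on (u, iu) with u orthogonal to the position vector, where it has
  -- imaginary part 2(n−2)h(u,u).
  obtain ⟨u, hu0, hu⟩ := exists_ne_zero_inner_eq_zero (by omega) (chartAt V x x)
  have h1 := hR x (frame x) (isUnitaryFrame_frame x) u (Complex.I • u : V)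
  have h2 := (congrArg Complex.im ((firstRicci_of_isBismut hD x (frame x) u
    (Complex.I • u : V)).symm.trans h1)).symm.trans (firstRicci_frame_im x hu)
  have h4 : 0 < (hopfForm (chartAt V x x) u u).re := by
    have h5 := (hopfMetric V).pos x u hu0
    have h6 := hopfMetric_inner x u u
    linarith
  have h7 : (3 : ℝ) ≤ Module.finrank ℂ V := by exact_mod_cast h
  have h8 : 0 < 2 * ((Module.finrank ℂ V : ℝ) - 2) * (hopfForm (chartAt V x x) u u).re := by
    have : (0 : ℝ) < (Module.finrank ℂ V : ℝ) - 2 := by linarith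
    positivity
  exact h8.ne h2

theorem not_isFlat (h : 3 ≤ Module.finrank ℂ V) {D : AffineConnection V (Hopf V)}
    (hD : (hopfMetric V).IsBismut D) : ¬ D.IsFlat := by
  intro hF
  refine not_firstRicciVanishes h hD fun x ε _ u v ↦ Finset.sum_eq_zero fun i _ ↦ ?_
  rw [HermitianMetric.complexCurvature, hF, hF]
  simp
  rfl

end Hopf
end HopfRicci

end

theorem mainTheorem12 (n : ℕ) :
    (hopfMetric (EuclideanSpace ℂ (Fin n))).IsBismutAmbroseSinger ∧
      (3 ≤ n → ∀ D : AffineConnection (EuclideanSpace ℂ (Fin n)) (Hopf (EuclideanSpace ℂ (Fin n))),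
        (hopfMetric (EuclideanSpace ℂ (Fin n))).IsBismut D →
          ¬ (hopfMetric (EuclideanSpace ℂ (Fin n))).FirstRicciVanishes D ∧ ¬ D.IsFlat) := by
  refine ⟨Hopf.isBismutAmbroseSinger _, fun hn D hD ↦ ?_⟩
  have h : 3 ≤ Module.finrank ℂ (EuclideanSpace ℂ (Fin n)) := by simpa using hn
  exact ⟨Hopf.not_firstRicciVanishes h hD, Hopf.not_isFlat h hD⟩
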